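/- Identify $\mathbb R^4$ with the quaternions $\mathbb H$ via $x_1+ix_2+jx_3+kx_4$ (Euclidean norm). For unit quaternions $l,r$ let $[l,r]\in SO(4)$ be the map $x\mapsto \bar l\,x\,r$, and put $e_s=e^{\pi i/s}$. For odd $m\ge 3$ define the following groups of rotations of $\mathbb R^4$, by generators: $$G_1(m)=\langle[e_m,1],[1,i],[1,j],[j,e_4]\rangle,\quad G_2(m)=\langle[e_m,1],[1,i],[e_{2m},j],[j,e_4]\rangle,\quad G_3(m)=\langle[e_m,1],[1,i],[j,1],[1,j]\rangle .$$ Let $G$ be one of the groups $G_1(m),G_2(m),G_3(m)$. A *$G$-equivariant bifurcation problem* is a $C^\infty$ map $F:\mathbb R^4\times\mathbb R\to\mathbb R^4$ (a one-parameter family of vector fields) with $F(gx,p)=gF(x,p)$ for all $g\in G$, and with critical linearisation $D_xF(0,0)=0$ at the trivial equilibrium. It *loses stability* at $p=0$ if $D_xF(0,p)=\sigma(p)\,\mathrm{Id}$ for all $p$ (so $\sigma(0)=0$) with $\sigma$ differentiable at $0$ and $\sigma'(0)\neq 0$. *Nontrivial equilibria bifurcate* at $(0,0)$ if there are $\varepsilon\in\{1,-1\}$,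 $\delta>0$ and a continuous map $x:[0,\delta)\to\mathbb R^4$ with $x(0)=0$ and, for all $0<s<\delta$, $x(s)\ne0$ and $F(x(s),\varepsilon s)=0$. **Theorem.** Let $m\ge3$ be odd and $G\in\{G_1(m),G_2(m),G_3(m)\}$. Then the action of $G$ on $\mathbb R^4$ is absolutely irreducible, i.e. every real-linear map commuting with $G$ is a real multiple of the identity. Moreover, in the set of all $G$-equivariant bifurcation problems there is a subset $U$ that is open and dense, both for the weak $C^\infty$ topology (uniform convergence of all derivatives on compact sets) and for the Whitney $C^\infty$ topology, such that every $F\in U$ loses stability at $p=0$ and has nontrivial equilibria bifurcating at $(0,0)$. (So generically loss of stability leads to bifurcation of nontrivial equilibria, and in this sense Ize's conjecture holds for these groups.) -/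

import Mathlib

open scoped Quaternion ContDiff

noncomputable section

namespace Ize

/-! ### Rotations of four-space in quaternion notation -/

/-- The map `[l, r] : x ↦ l̄ x r` of `ℝ⁴ = ℍ`, for unit quaternions `l`, `r`. -/
def rot (l r : unitary ℍ[ℝ]) : ℍ[ℝ] ≃ₗᵢ[ℝ] ℍ[ℝ] where
  toFun x := star (l : ℍ[ℝ]) * x * (r : ℍ[ℝ])
  invFun x := (l : ℍ[ℝ]) * x * star (r : ℍ[ℝ])
  map_add' x y := by rw [mul_add, add_mul]
  map_smul' c x := by simp
  left_inv x := by
    have h1 : (l : ℍ[ℝ]) * star (l : ℍ[ℝ]) = 1 := Unitary.mul_star_self_of_mem l.2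
    have h2 : (r : ℍ[ℝ]) * star (r : ℍ[ℝ]) = 1 := Unitary.mul_star_self_of_mem r.2
    calc (l : ℍ[ℝ]) * (star (l : ℍ[ℝ]) * x * r) * star (r : ℍ[ℝ])
        = ((l : ℍ[ℝ]) * star (l : ℍ[ℝ])) * x * (r * star (r : ℍ[ℝ])) := by
          simp only [mul_assoc]
      _ = x := by rw [h1, h2, one_mul, mul_one]
  right_inv x := by
    have h1 : star (l : ℍ[ℝ]) * (l : ℍ[ℝ]) = 1 := Unitary.star_mul_self_of_mem l.2
    have h2 : star (r : ℍ[ℝ]) * (r : ℍ[ℝ]) = 1 := Unitary.star_mul_self_of_mem r.2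
    calc star (l : ℍ[ℝ]) * ((l : ℍ[ℝ]) * x * star (r : ℍ[ℝ])) * r
        = (star (l : ℍ[ℝ]) * (l : ℍ[ℝ])) * x * (star (r : ℍ[ℝ]) * r) := by
          simp only [mul_assoc]
      _ = x := by rw [h1, h2, one_mul, mul_one]
  norm_map' x := by
    have h1 : ‖(l : ℍ[ℝ])‖ = 1 := CStarRing.norm_of_mem_unitary l.2
    have h2 : ‖(r : ℍ[ℝ])‖ = 1 := CStarRing.norm_of_mem_unitary r.2
    change ‖star (l : ℍ[ℝ]) * x * (r : ℍ[ℝ])‖ = ‖x‖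
    rw [norm_mul, norm_mul, norm_star, h1, h2, one_mul, mul_one]

theorem mem_unitary_of_sq_sum (q : ℍ[ℝ])
    (h : q.re ^ 2 + q.imI ^ 2 + q.imJ ^ 2 + q.imK ^ 2 = 1) : q ∈ unitary ℍ[ℝ] := by
  have hq : Quaternion.normSq q = 1 := by rw [Quaternion.normSq_def', h]
  rw [Unitary.mem_iff, Quaternion.star_mul_self, Quaternion.self_mul_star, hq]
  exact ⟨rfl, rfl⟩

/-- The unit quaternion `i`. -/
def qi : unitary ℍ[ℝ] :=
  ⟨(⟨0, 1, 0, 0⟩ : ℍ[ℝ]), mem_unitary_of_sq_sum _ (by norm_num)⟩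

/-- The unit quaternion `j`. -/
def qj : unitary ℍ[ℝ] :=
  ⟨(⟨0, 0, 1, 0⟩ : ℍ[ℝ]), mem_unitary_of_sq_sum _ (by norm_num)⟩

/-- The unit quaternion `e_s = exp(π i / s) = cos(π/s) + i sin(π/s)`. -/
def qe (s : ℕ) : unitary ℍ[ℝ] :=
  ⟨(⟨Real.cos (Real.pi / s), Real.sin (Real.pi / s), 0, 0⟩ : ℍ[ℝ]),
    mem_unitary_of_sq_sum _ (by simp)⟩

/-- `G₁(m) = ⟨[e_m, 1], [1, i], [1, j], [j, e_4]⟩`. -/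
def G₁ (m : ℕ) : Subgroup (ℍ[ℝ] ≃ₗᵢ[ℝ] ℍ[ℝ]) :=
  Subgroup.closure {rot (qe m) 1, rot 1 qi, rot 1 qj, rot qj (qe 4)}

/-- `G₂(m) = ⟨[e_m, 1], [1, i], [e_{2m}, j], [j, e_4]⟩`. -/
def G₂ (m : ℕ) : Subgroup (ℍ[ℝ] ≃ₗᵢ[ℝ] ℍ[ℝ]) :=
  Subgroup.closure {rot (qe m) 1, rot 1 qi, rot (qe (2 * m)) qj, rot qj (qe 4)}

/-- `G₃(m) = ⟨[e_m, 1], [1, i], [j, 1], [1, j]⟩`. -/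
def G₃ (m : ℕ) : Subgroup (ℍ[ℝ] ≃ₗᵢ[ℝ] ℍ[ℝ]) :=
  Subgroup.closure {rot (qe m) 1, rot 1 qi, rot qj 1, rot 1 qj}

/-- Absolute irreducibility of the natural action of `G` on `ℝ⁴ = ℍ`: the only real-linear maps
commuting with `G` are the multiples of the identity. -/
def AbsolutelyIrreducible (G : Subgroup (ℍ[ℝ] ≃ₗᵢ[ℝ] ℍ[ℝ])) : Prop :=
  ∀ A : ℍ[ℝ] →ₗ[ℝ] ℍ[ℝ], (∀ g ∈ G, ∀ x, A (g x) = g (A x)) → ∃ c : ℝ, ∀ x, A x = c • x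

/-! ### Equivariant bifurcation problems -/

/-- A one-parameter family of vector fields `F(x, p)` on `ℝ⁴ = ℍ`, smooth in `(x, p)` and
`G`-equivariant in `x`, whose linearisation at the trivial equilibrium `x = 0` is critical
at the parameter value `p = 0`. -/
structure BifurcationProblem (G : Subgroup (ℍ[ℝ] ≃ₗᵢ[ℝ] ℍ[ℝ])) where
  /-- the family of vector fields -/
  toFun : ℍ[ℝ] × ℝ → ℍ[ℝ]
  smooth : ContDiff ℝ ∞ toFun
  equivariant : ∀ g ∈ G, ∀ (x : ℍ[ℝ]) (p : ℝ), toFun (g x, p) = g (toFun (x, p))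
  critical : fderiv ℝ (fun x : ℍ[ℝ] => toFun (x, 0)) 0 = 0

namespace BifurcationProblem

variable {G : Subgroup (ℍ[ℝ] ≃ₗᵢ[ℝ] ℍ[ℝ])}

/-- Loss of stability of the trivial equilibrium at `p = 0`: the linearisation at `x = 0` is
`σ(p)` times the identity, and the critical eigenvalue `σ` (which vanishes at `p = 0`) crosses
zero with nonzero speed, `σ'(0) ≠ 0`. -/
def LosesStability (F : BifurcationProblem G) : Prop :=
  ∃ (σ : ℝ → ℝ) (d : ℝ),
    (∀ p : ℝ, fderiv ℝ (fun x : ℍ[ℝ] => F.toFun (x, p)) 0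
      = σ p • ContinuousLinearMap.id ℝ ℍ[ℝ]) ∧
    HasDerivAt σ d 0 ∧ d ≠ 0

/-- Bifurcation of nontrivial equilibria at `(0, 0)`: on one side of `p = 0` (`ε = 1` or
`ε = -1`) there is a continuous branch `x(p)`, `p = ε s`, of nontrivial equilibria, which
emanates from the trivial equilibrium. -/
def HasNontrivialBranch (F : BifurcationProblem G) : Prop :=
  ∃ (ε : ℝ) (δ : ℝ) (x : ℝ → ℍ[ℝ]), (ε = 1 ∨ ε = -1) ∧ 0 < δ ∧
    ContinuousOn x (Set.Ico 0 δ) ∧ x 0 = 0 ∧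
    ∀ s ∈ Set.Ioo 0 δ, x s ≠ 0 ∧ F.toFun (x s, ε * s) = 0

/-! ### The two `C^∞` topologies -/

/-- All derivatives of `H` and `F` of order at most `k` differ by less than `ε` on the set `K`. -/
def CloseOn (K : Set (ℍ[ℝ] × ℝ)) (k : ℕ) (ε : ℍ[ℝ] × ℝ → ℝ) (F H : BifurcationProblem G) : Prop :=
  ∀ q ∈ K, ∀ i ≤ k, ‖iteratedFDeriv ℝ i H.toFun q - iteratedFDeriv ℝ i F.toFun q‖ < ε q

/-- The weak `C^∞` topology: uniform convergence of all derivatives on compact sets. -/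
@[reducible]
def weakTopology (G : Subgroup (ℍ[ℝ] ≃ₗᵢ[ℝ] ℍ[ℝ])) :
    TopologicalSpace (BifurcationProblem G) where
  IsOpen U := ∀ F ∈ U, ∃ (K : Set (ℍ[ℝ] × ℝ)) (k : ℕ) (ε : ℝ), IsCompact K ∧ 0 < ε ∧
    {H | CloseOn K k (fun _ => ε) F H} ⊆ U
  isOpen_univ F _ := ⟨∅, 0, 1, isCompact_empty, one_pos, Set.subset_univ _⟩
  isOpen_inter U V hU hV F hF := by
    obtain ⟨K, k, ε, hK, hε, h⟩ := hU F hF.1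
    obtain ⟨K', k', ε', hK', hε', h'⟩ := hV F hF.2
    refine ⟨K ∪ K', max k k', min ε ε', hK.union hK', lt_min hε hε', fun H hH => ⟨h ?_, h' ?_⟩⟩
    · exact fun q hq i hi =>
        (hH q (Or.inl hq) i (hi.trans (le_max_left _ _))).trans_le (min_le_left _ _)
    · exact fun q hq i hi =>
        (hH q (Or.inr hq) i (hi.trans (le_max_right _ _))).trans_le (min_le_right _ _)
  isOpen_sUnion S hS F hF := by
    obtain ⟨U, hU, hFU⟩ := hF
    obtain ⟨K, k, ε, hK, hε, h⟩ := hS U hU F hFU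
    exact ⟨K, k, ε, hK, hε, h.trans (Set.subset_sUnion_of_mem hU)⟩

/-- The strong (Whitney) `C^∞` topology: derivatives up to a finite order are controlled on the
whole space by an arbitrary positive continuous function. -/
@[reducible]
def whitneyTopology (G : Subgroup (ℍ[ℝ] ≃ₗᵢ[ℝ] ℍ[ℝ])) :
    TopologicalSpace (BifurcationProblem G) where
  IsOpen U := ∀ F ∈ U, ∃ (k : ℕ) (ε : ℍ[ℝ] × ℝ → ℝ), Continuous ε ∧ (∀ q, 0 < ε q) ∧
    {H | CloseOn Set.univ k ε F H} ⊆ U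
  isOpen_univ F _ := ⟨0, fun _ => 1, continuous_const, fun _ => one_pos, Set.subset_univ _⟩
  isOpen_inter U V hU hV F hF := by
    obtain ⟨k, ε, hc, hε, h⟩ := hU F hF.1
    obtain ⟨k', ε', hc', hε', h'⟩ := hV F hF.2
    refine ⟨max k k', fun q => min (ε q) (ε' q), hc.min hc', fun q => lt_min (hε q) (hε' q),
      fun H hH => ⟨h ?_, h' ?_⟩⟩
    · exact fun q hq i hi =>
        (hH q hq i (hi.trans (le_max_left _ _))).trans_le (min_le_left _ _)
    · exact fun q hq i hi =>
        (hH q hq i (hi.trans (le_max_right _ _))).trans_le (min_le_right _ _)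
  isOpen_sUnion S hS F hF := by
    obtain ⟨U, hU, hFU⟩ := hF
    obtain ⟨k, ε, hc, hε, h⟩ := hS U hU F hFU
    exact ⟨k, ε, hc, hε, h.trans (Set.subset_sUnion_of_mem hU)⟩

end BifurcationProblem

end Ize

end

/-! Write ℍ = ℂ ⊕ ℂj. Each group has an element `[l, r]` with l, r ∈ ℂj. It acts as a reflection on
each summand, so it fixes a plane spanned by unit vectors u ∈ ℂ and w ∈ ℂj (`exists_frame`).
Equivariance makes F preserve this plane, so it suffices to find a branch there.

Since -1 = `[1, i]²` lies in the group, F is odd in x. Hence F = p·B(x, p)x + T(x)(x, x, x), where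
B(0, 0) = d·Id by absolute irreducibility and d = σ'(0) (`exists_expansion`). Equivariance under
`[e_m, 1]` and `[1, i]` forces the cubic part to map ℂ into ℂ (`inC_cubic_of_equivariant`), so
within the plane u is an invariant direction of the cubic. Let α be its radial coefficient, and β
the coefficient of a²b in the w-component at au + bw.

The scaling x = t(au + bw), p = εt² and division by t³ give an equation which at t = 0 has the root
(a, b) = (ρ, 0), ρ² = -εd/α. Its linearisation there is triangular with diagonal 2ρ²α, ρ²(β - α). If
d, α and β - α are nonzero, the implicit function theorem yields the branch
(`exists_branch_of_nondegenerate`).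

These three conditions concern finitely many derivatives at the origin, so they are open. They are
dense because a cut-off multiple of px + `cubic` x is an equivariant perturbation moving all three
quantities (`dense_nondegenerate_whitney`). -/

namespace Ize

open MeasureTheory Set Filter Topology

/-! ### Hadamard's lemma with parameters, and derivatives along lines. -/

section Hadamard

universe u

/-- An integral over a compact interval of a `C^n` function depends `C^n` on parameters. -/
theorem contDiff_intervalIntegral_param {E : Type u} [NormedAddCommGroup E] [NormedSpace ℝ E]
    [ProperSpace E] (n : ℕ) : ∀ {E' : Type u} [NormedAddCommGroup E'] [NormedSpace ℝ E']
    {f : E → ℝ → E'}, ContDiff ℝ n (Function.uncurry f) →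
      ContDiff ℝ n fun x => ∫ t in (0 : ℝ)..1, f x t := by
  -- The codomain stays quantified because the derivative in the parameter takes values in `E →L[ℝ]
  -- E'`. A single universe keeps that space within the induction hypothesis.
  induction n with
  | zero =>
    intro E' _ _ f hf
    rw [Nat.cast_zero, contDiff_zero] at hf ⊢
    exact intervalIntegral.continuous_parametric_intervalIntegral_of_continuous' hf 0 1
  | succ n ih =>
    intro E' _ _ f hf
    have hd : Differentiable ℝ (Function.uncurry f) := hf.differentiable (by simp)
    set f' : E → ℝ → E →L[ℝ] E' := fun x t =>
      (fderiv ℝ (Function.uncurry f) (x, t)).comp (ContinuousLinearMap.inl ℝ E ℝ) with hf'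
    have hfd : ∀ x t, HasFDerivAt (fun y => f y t) (f' x t) x := fun x t =>
      HasFDerivAt.comp x (g := Function.uncurry f) (f := fun y => (y, t)) (hd (x, t)).hasFDerivAt
        (hasFDerivAt_prodMk_left x t)
    have hc' : ContDiff ℝ n (Function.uncurry f') := by
      have h := (hf.fderiv_right (m := n) (by norm_cast))
      exact h.clm_comp contDiff_const
    have key : ∀ x, HasFDerivAt (fun x => ∫ t in (0 : ℝ)..1, f x t) (∫ t in (0 : ℝ)..1, f' x t) x := by
      intro x
      obtain ⟨C, hC⟩ := ((isCompact_closedBall x 1).prod (isCompact_Icc (a := (0 : ℝ)) (b := 1))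
        ).exists_bound_of_continuousOn hc'.continuous.continuousOn
      have hcf : Continuous (Function.uncurry f) := hf.continuous
      have hcx : ∀ y, Continuous (f y) := fun y => hcf.comp (Continuous.prodMk_right y)
      have hcx' : Continuous (f' x) := hc'.continuous.comp (Continuous.prodMk_right x)
      refine intervalIntegral.hasFDerivAt_integral_of_dominated_of_fderiv_le (𝕜 := ℝ)
        (bound := fun _ => C)
        (Metric.closedBall_mem_nhds x one_pos) (Eventually.of_forall fun y =>
          (hcx y).aestronglyMeasurable) ((hcx x).intervalIntegrable _ _)
          hcx'.aestronglyMeasurable ?_ intervalIntegrable_const ?_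
      · refine Eventually.of_forall fun t ht y hy => hC (y, t) ⟨hy, ?_⟩
        rw [uIoc_of_le zero_le_one] at ht
        exact ⟨ht.1.le, ht.2⟩
      · exact Eventually.of_forall fun t _ y _ => hfd y t
    rw [Nat.cast_succ, contDiff_succ_iff_hasFDerivAt]
    exact ⟨_, ih hc', key⟩

/-- Hadamard's lemma with parameters. -/
theorem exists_contDiff_eq_add_apply {E P E' : Type u} [NormedAddCommGroup E] [NormedSpace ℝ E]
    [ProperSpace E] [NormedAddCommGroup P] [NormedSpace ℝ P] [ProperSpace P]
    [NormedAddCommGroup E'] [NormedSpace ℝ E'] [CompleteSpace E'] {f : E × P → E'}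
    (hf : ContDiff ℝ ∞ f) :
    ∃ A : E × P → E →L[ℝ] E', ContDiff ℝ ∞ A ∧ ∀ x p, f (x, p) = f (0, p) + A (x, p) x := by
  set D : E × P → ℝ → E →L[ℝ] E' := fun q t =>
    (fderiv ℝ f (t • q.1, q.2)).comp (ContinuousLinearMap.inl ℝ E P) with hD
  have hDc : ContDiff ℝ ∞ (Function.uncurry D) := by
    have h1 : ContDiff ℝ ∞ (fderiv ℝ f) := hf.fderiv_right (by simp)
    refine ContDiff.clm_comp (h1.comp ?_) contDiff_const
    fun_prop
  refine ⟨fun q => ∫ t in (0 : ℝ)..1, D q t, contDiff_infty.2 fun n =>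
    contDiff_intervalIntegral_param n (hDc.of_le (by exact_mod_cast le_top)), fun x p => ?_⟩
  have hc : Continuous fun t => D (x, p) t := hDc.continuous.comp (Continuous.prodMk_right _)
  have hderiv : ∀ t ∈ uIcc (0 : ℝ) 1,
      HasDerivAt (fun t : ℝ => f (t • x, p)) (D (x, p) t x) t := by
    intro t _
    have h1 : HasDerivAt (fun t : ℝ => (t • x, p)) (x, (0 : P)) t := by
      simpa using ((hasDerivAt_id t).smul_const x).prodMk (hasDerivAt_const t p)
    have h2 := ((hf.differentiable (by simp)) (t • x, p)).hasFDerivAt.comp_hasDerivAt t h1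
    have h3 : D (x, p) t x = fderiv ℝ f (t • x, p) (x, 0) := by simp [hD]
    rw [h3]
    exact h2
  have h3 := intervalIntegral.integral_eq_sub_of_hasDerivAt hderiv
    ((hc.clm_apply continuous_const).intervalIntegrable _ _)
  have h4 : (∫ t in (0 : ℝ)..1, D (x, p) t) x = ∫ t in (0 : ℝ)..1, D (x, p) t x :=
    (ContinuousLinearMap.intervalIntegral_apply (hc.intervalIntegrable _ _) x)
  show _ = _ + (∫ t in (0 : ℝ)..1, D (x, p) t) x
  rw [h4, h3]
  simp

/-- If `f (t v) = t ^ n m(t)`, the `n`-th derivative of `f` at `0` in the direction `v`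
is `n! m(0)`. -/
theorem iteratedDeriv_pow_smul {E' : Type*} [NormedAddCommGroup E'] [NormedSpace ℝ E'] (n : ℕ) :
    ∀ {m : ℝ → E'}, ContDiff ℝ ∞ m →
      iteratedDeriv n (fun t => t ^ n • m t) 0 = (n.factorial : ℝ) • m 0 := by
  induction n with
  | zero => intro m _; simp
  | succ n ih =>
    intro m hm
    have hd : deriv (fun t => t ^ (n + 1) • m t)
        = fun t => t ^ n • (((n : ℝ) + 1) • m t + t • deriv m t) := by
      ext t
      have h := (hasDerivAt_pow (n + 1) t).smul ((hm.differentiable (by simp)) t).hasDerivAt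
      refine h.deriv.trans ?_
      simp only [Nat.cast_add, Nat.cast_one, Nat.add_sub_cancel, smul_add, smul_smul, pow_succ]
      rw [add_comm, mul_comm (t ^ n), mul_comm (t ^ n)]
    have hm' : ContDiff ℝ ∞ (deriv m) := (contDiff_infty_iff_deriv.1 hm).2
    rw [iteratedDeriv_succ', hd, ih (by fun_prop)]
    simp [Nat.factorial_succ, smul_smul, mul_comm]

theorem iteratedFDeriv_zero_apply_of_pow {E E' : Type*} [NormedAddCommGroup E] [NormedSpace ℝ E]
    [NormedAddCommGroup E'] [NormedSpace ℝ E'] {f : E → E'} (hf : ContDiff ℝ ∞ f) (v : E) (n : ℕ)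
    {m : ℝ → E'} (hm : ContDiff ℝ ∞ m) (h : ∀ t : ℝ, f (t • v) = t ^ n • m t) :
    iteratedFDeriv ℝ n f 0 (fun _ => v) = (n.factorial : ℝ) • m 0 := by
  rw [← iteratedDeriv_pow_smul n hm, iteratedDeriv_eq_iteratedFDeriv]
  have h1 : (fun t : ℝ => t ^ n • m t) = f ∘ (ContinuousLinearMap.toSpanSingleton ℝ v) := by
    ext t; simp [h]
  rw [h1, ContinuousLinearMap.iteratedFDeriv_comp_right _ hf (x := 0) (i := n)
    (by exact_mod_cast le_top)]
  simp

end Hadamard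

/-! ### The splitting ℂ ⊕ ℂj, the equivariant cubic, and absolute irreducibility. -/

section Algebra

/-- The quaternion lies in the complex line `ℂ = span(1, i)`. -/
def InC (q : ℍ[ℝ]) : Prop := q.imJ = 0 ∧ q.imK = 0

/-- The quaternion lies in the complex line `ℂ j = span(j, k)`. -/
def InCj (q : ℍ[ℝ]) : Prop := q.re = 0 ∧ q.imI = 0

theorem sq_sum_of_unitary (l : unitary ℍ[ℝ]) :
    (l : ℍ[ℝ]).re ^ 2 + (l : ℍ[ℝ]).imI ^ 2 + (l : ℍ[ℝ]).imJ ^ 2 + (l : ℍ[ℝ]).imK ^ 2 = 1 := by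
  rw [← Quaternion.normSq_def', Quaternion.normSq_eq_norm_mul_self,
    CStarRing.norm_of_mem_unitary l.2, mul_one]

theorem rot_apply (l r : unitary ℍ[ℝ]) (x : ℍ[ℝ]) :
    rot l r x = star (l : ℍ[ℝ]) * x * (r : ℍ[ℝ]) := rfl

theorem rot_mul (l r l' r' : unitary ℍ[ℝ]) : rot l r * rot l' r' = rot (l' * l) (r' * r) := by
  ext1 x
  simp only [LinearIsometryEquiv.coe_mul, Function.comp_apply, rot_apply, Submonoid.coe_mul,
    star_mul, mul_assoc]

/-- The difference `|z₁|² - |z₂|²` of the squared norms of the two components. -/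
def normSqDiff (x : ℍ[ℝ]) : ℝ := x.re ^ 2 + x.imI ^ 2 - x.imJ ^ 2 - x.imK ^ 2

/-- The linear map `z₁ + z₂ j ↦ -z₁ + z₂ j`. -/
def reflection (x : ℍ[ℝ]) : ℍ[ℝ] := ⟨-x.re, -x.imI, x.imJ, x.imK⟩

/-- The cubic map `z₁ + z₂ j ↦ (|z₁|² - |z₂|²) (-z₁ + z₂ j)`. -/
def cubic (x : ℍ[ℝ]) : ℍ[ℝ] := normSqDiff x • reflection x

theorem cubic_re (x : ℍ[ℝ]) : (cubic x).re
    = (x.re ^ 2 + x.imI ^ 2 - x.imJ ^ 2 - x.imK ^ 2) * -x.re := rfl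
theorem cubic_imI (x : ℍ[ℝ]) : (cubic x).imI
    = (x.re ^ 2 + x.imI ^ 2 - x.imJ ^ 2 - x.imK ^ 2) * -x.imI := rfl
theorem cubic_imJ (x : ℍ[ℝ]) : (cubic x).imJ
    = (x.re ^ 2 + x.imI ^ 2 - x.imJ ^ 2 - x.imK ^ 2) * x.imJ := rfl
theorem cubic_imK (x : ℍ[ℝ]) : (cubic x).imK
    = (x.re ^ 2 + x.imI ^ 2 - x.imJ ^ 2 - x.imK ^ 2) * x.imK := rfl

@[simp] theorem qi_re : (qi : ℍ[ℝ]).re = 0 := rfl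
@[simp] theorem qi_imI : (qi : ℍ[ℝ]).imI = 1 := rfl
@[simp] theorem qi_imJ : (qi : ℍ[ℝ]).imJ = 0 := rfl
@[simp] theorem qi_imK : (qi : ℍ[ℝ]).imK = 0 := rfl
@[simp] theorem qj_re : (qj : ℍ[ℝ]).re = 0 := rfl
@[simp] theorem qj_imI : (qj : ℍ[ℝ]).imI = 0 := rfl
@[simp] theorem qj_imJ : (qj : ℍ[ℝ]).imJ = 1 := rfl
@[simp] theorem qj_imK : (qj : ℍ[ℝ]).imK = 0 := rfl
@[simp] theorem qe_re (s : ℕ) : (qe s : ℍ[ℝ]).re = Real.cos (Real.pi / s) := rfl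
@[simp] theorem qe_imI (s : ℕ) : (qe s : ℍ[ℝ]).imI = Real.sin (Real.pi / s) := rfl
@[simp] theorem qe_imJ (s : ℕ) : (qe s : ℍ[ℝ]).imJ = 0 := rfl
@[simp] theorem qe_imK (s : ℕ) : (qe s : ℍ[ℝ]).imK = 0 := rfl

/-- A unit in ℂ preserves both summands and commutes with both factors of `cubic`. A unit in ℂj
exchanges the summands, so `normSqDiff` and `reflection` each contribute a sign, and the signs
cancel. -/
theorem cubic_mul_right (x : ℍ[ℝ]) (r : unitary ℍ[ℝ]) (hr : InC (r : ℍ[ℝ]) ∨ InCj (r : ℍ[ℝ])) :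
    cubic (x * r) = cubic x * r := by
  have h := sq_sum_of_unitary r
  generalize (r : ℍ[ℝ]) = q at h hr ⊢
  rcases hr with ⟨h1, h2⟩ | ⟨h1, h2⟩ <;> rw [h1, h2] at h
  · ext <;> simp [cubic_re, cubic_imI, cubic_imJ, cubic_imK, h1, h2]
    · linear_combination (-(x.re ^ 2 + x.imI ^ 2 - x.imJ ^ 2 - x.imK ^ 2) * (x.re * q.re - x.imI * q.imI)) * h
    · linear_combination (-(x.re ^ 2 + x.imI ^ 2 - x.imJ ^ 2 - x.imK ^ 2) * (x.re * q.imI + x.imI * q.re)) * h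
    · linear_combination ((x.re ^ 2 + x.imI ^ 2 - x.imJ ^ 2 - x.imK ^ 2) * (x.imJ * q.re + x.imK * q.imI)) * h
    · linear_combination ((x.re ^ 2 + x.imI ^ 2 - x.imJ ^ 2 - x.imK ^ 2) * (x.imK * q.re - x.imJ * q.imI)) * h
  · ext <;> simp [cubic_re, cubic_imI, cubic_imJ, cubic_imK, h1, h2]
    · linear_combination (-(x.re ^ 2 + x.imI ^ 2 - x.imJ ^ 2 - x.imK ^ 2) * (x.imJ * q.imJ + x.imK * q.imK)) * h
    · linear_combination ((x.re ^ 2 + x.imI ^ 2 - x.imJ ^ 2 - x.imK ^ 2) * (x.imJ * q.imK - x.imK * q.imJ)) * h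
    · linear_combination (-(x.re ^ 2 + x.imI ^ 2 - x.imJ ^ 2 - x.imK ^ 2) * (x.re * q.imJ - x.imI * q.imK)) * h
    · linear_combination (-(x.re ^ 2 + x.imI ^ 2 - x.imJ ^ 2 - x.imK ^ 2) * (x.re * q.imK + x.imI * q.imJ)) * h

theorem cubic_mul_left (x : ℍ[ℝ]) (r : unitary ℍ[ℝ]) (hr : InC (r : ℍ[ℝ]) ∨ InCj (r : ℍ[ℝ])) :
    cubic (star (r : ℍ[ℝ]) * x) = star (r : ℍ[ℝ]) * cubic x := by
  have h := sq_sum_of_unitary r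
  generalize (r : ℍ[ℝ]) = q at h hr ⊢
  rcases hr with ⟨h1, h2⟩ | ⟨h1, h2⟩ <;> rw [h1, h2] at h
  · ext <;> simp [cubic_re, cubic_imI, cubic_imJ, cubic_imK, h1, h2]
    · linear_combination (-(x.re ^ 2 + x.imI ^ 2 - x.imJ ^ 2 - x.imK ^ 2) * (x.re * q.re + x.imI * q.imI)) * h
    · linear_combination (-(x.re ^ 2 + x.imI ^ 2 - x.imJ ^ 2 - x.imK ^ 2) * (-x.re * q.imI + x.imI * q.re)) * h
    · linear_combination ((x.re ^ 2 + x.imI ^ 2 - x.imJ ^ 2 - x.imK ^ 2) * (x.imJ * q.re + x.imK * q.imI)) * h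
    · linear_combination ((x.re ^ 2 + x.imI ^ 2 - x.imJ ^ 2 - x.imK ^ 2) * (x.imK * q.re - x.imJ * q.imI)) * h
  · ext <;> simp [cubic_re, cubic_imI, cubic_imJ, cubic_imK, h1, h2]
    · linear_combination ((x.re ^ 2 + x.imI ^ 2 - x.imJ ^ 2 - x.imK ^ 2) * (x.imJ * q.imJ + x.imK * q.imK)) * h
    · linear_combination (-(x.re ^ 2 + x.imI ^ 2 - x.imJ ^ 2 - x.imK ^ 2) * (x.imK * q.imJ - x.imJ * q.imK)) * h
    · linear_combination ((x.re ^ 2 + x.imI ^ 2 - x.imJ ^ 2 - x.imK ^ 2) * (x.re * q.imJ + x.imI * q.imK)) * h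
    · linear_combination ((x.re ^ 2 + x.imI ^ 2 - x.imJ ^ 2 - x.imK ^ 2) * (x.re * q.imK - x.imI * q.imJ)) * h

/-- The structure shared by the groups `G₁(m)`, `G₂(m)`, `G₃(m)`. -/
structure Admissible (m : ℕ) (G : Subgroup (ℍ[ℝ] ≃ₗᵢ[ℝ] ℍ[ℝ])) : Prop where
  rot_e : rot (qe m) 1 ∈ G
  rot_i : rot 1 qi ∈ G
  exists_diag : ∃ l r : unitary ℍ[ℝ], InCj (l : ℍ[ℝ]) ∧ InCj (r : ℍ[ℝ]) ∧ rot l r ∈ G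
  exists_swap : ∃ l r : unitary ℍ[ℝ], InCj (l : ℍ[ℝ]) ∧ InC (r : ℍ[ℝ]) ∧ rot l r ∈ G
  cubic_equivariant : ∀ g ∈ G, ∀ x, cubic (g x) = g (cubic x)

theorem inC_one : InC ((1 : unitary ℍ[ℝ]) : ℍ[ℝ]) := by simp [InC]
theorem inC_qi : InC (qi : ℍ[ℝ]) := by simp [InC, qi]
theorem inC_qe (s : ℕ) : InC (qe s : ℍ[ℝ]) := by simp [InC, qe]
theorem inCj_qj : InCj (qj : ℍ[ℝ]) := by simp [InCj, qj]

theorem InCj.mul_inC {p q : ℍ[ℝ]} (hp : InCj p) (hq : InC q) : InCj (p * q) := by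
  simp [InCj, hp.1, hp.2, hq.1, hq.2]

theorem InC.mul_inCj {p q : ℍ[ℝ]} (hp : InC p) (hq : InCj q) : InCj (p * q) := by
  simp [InCj, hp.1, hp.2, hq.1, hq.2]

theorem cubic_equivariant_closure {S : Set (ℍ[ℝ] ≃ₗᵢ[ℝ] ℍ[ℝ])}
    (hS : ∀ g ∈ S, ∃ l r : unitary ℍ[ℝ], (InC (l : ℍ[ℝ]) ∨ InCj (l : ℍ[ℝ])) ∧
      (InC (r : ℍ[ℝ]) ∨ InCj (r : ℍ[ℝ])) ∧ g = rot l r) :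
    ∀ g ∈ Subgroup.closure S, ∀ x, cubic (g x) = g (cubic x) := by
  intro g hg
  induction hg using Subgroup.closure_induction with
  | mem g hg =>
    obtain ⟨l, r, hl, hr, rfl⟩ := hS g hg
    intro x
    rw [rot_apply, rot_apply, cubic_mul_right _ _ hr, cubic_mul_left _ _ hl]
  | one => intro x; rfl
  | mul g h _ _ ihg ihh =>
    intro x
    rw [LinearIsometryEquiv.coe_mul, Function.comp_apply, Function.comp_apply, ihg, ihh]
  | inv g _ ih =>
    intro x
    apply g.injective
    rw [← ih]
    simp only [LinearIsometryEquiv.coe_inv, LinearIsometryEquiv.apply_symm_apply]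

/-- In all three groups the product of the last two generators has both entries in ℂj, and `[j,
e_4]` or `[j, 1]` exchanges ℂ and ℂj. -/
theorem admissible_of_mem {m : ℕ} {G : Subgroup (ℍ[ℝ] ≃ₗᵢ[ℝ] ℍ[ℝ])}
    (hG : G = G₁ m ∨ G = G₂ m ∨ G = G₃ m) : Admissible m G := by
  rcases hG with rfl | rfl | rfl
  · have h3 : rot 1 qj ∈ G₁ m := Subgroup.subset_closure (by simp)
    have h4 : rot qj (qe 4) ∈ G₁ m := Subgroup.subset_closure (by simp)
    refine ⟨Subgroup.subset_closure (by simp), Subgroup.subset_closure (by simp),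
      ⟨1 * qj, qj * qe 4, ?_, inCj_qj.mul_inC (inC_qe 4), rot_mul qj (qe 4) 1 qj ▸ mul_mem h4 h3⟩,
      ⟨qj, qe 4, inCj_qj, inC_qe 4, h4⟩, cubic_equivariant_closure ?_⟩
    · exact inC_one.mul_inCj inCj_qj
    · simp only [mem_insert_iff, mem_singleton_iff]
      rintro g (rfl | rfl | rfl | rfl)
      exacts [⟨_, _, .inl (inC_qe m), .inl inC_one, rfl⟩, ⟨_, _, .inl inC_one, .inl inC_qi, rfl⟩,
        ⟨_, _, .inl inC_one, .inr inCj_qj, rfl⟩, ⟨_, _, .inr inCj_qj, .inl (inC_qe 4), rfl⟩]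
  · have h3 : rot (qe (2 * m)) qj ∈ G₂ m := Subgroup.subset_closure (by simp)
    have h4 : rot qj (qe 4) ∈ G₂ m := Subgroup.subset_closure (by simp)
    refine ⟨Subgroup.subset_closure (by simp), Subgroup.subset_closure (by simp),
      ⟨qe (2 * m) * qj, qj * qe 4, (inC_qe _).mul_inCj inCj_qj, inCj_qj.mul_inC (inC_qe 4),
        rot_mul qj (qe 4) _ qj ▸ mul_mem h4 h3⟩,
      ⟨qj, qe 4, inCj_qj, inC_qe 4, h4⟩, cubic_equivariant_closure ?_⟩
    simp only [mem_insert_iff, mem_singleton_iff]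
    rintro g (rfl | rfl | rfl | rfl)
    exacts [⟨_, _, .inl (inC_qe m), .inl inC_one, rfl⟩, ⟨_, _, .inl inC_one, .inl inC_qi, rfl⟩,
      ⟨_, _, .inl (inC_qe _), .inr inCj_qj, rfl⟩, ⟨_, _, .inr inCj_qj, .inl (inC_qe 4), rfl⟩]
  · have h3 : rot qj 1 ∈ G₃ m := Subgroup.subset_closure (by simp)
    have h4 : rot 1 qj ∈ G₃ m := Subgroup.subset_closure (by simp)
    refine ⟨Subgroup.subset_closure (by simp), Subgroup.subset_closure (by simp),
      ⟨qj * 1, 1 * qj, inCj_qj.mul_inC inC_one, inC_one.mul_inCj inCj_qj,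
        rot_mul 1 qj qj 1 ▸ mul_mem h4 h3⟩,
      ⟨qj, 1, inCj_qj, inC_one, h3⟩, cubic_equivariant_closure ?_⟩
    simp only [mem_insert_iff, mem_singleton_iff]
    rintro g (rfl | rfl | rfl | rfl)
    exacts [⟨_, _, .inl (inC_qe m), .inl inC_one, rfl⟩, ⟨_, _, .inl inC_one, .inl inC_qi, rfl⟩,
      ⟨_, _, .inr inCj_qj, .inl inC_one, rfl⟩, ⟨_, _, .inl inC_one, .inr inCj_qj, rfl⟩]

theorem sin_pi_div_ne_zero {m : ℕ} (hm : 3 ≤ m) : Real.sin (Real.pi / m) ≠ 0 := by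
  have h : (3 : ℝ) ≤ m := by exact_mod_cast hm
  refine (Real.sin_pos_of_pos_of_lt_pi (by positivity) ?_).ne'
  exact div_lt_self Real.pi_pos (by linarith)

theorem quaternion_eq_basis (x : ℍ[ℝ]) :
    x = x.re • 1 + x.imI • (qi : ℍ[ℝ]) + x.imJ • (qj : ℍ[ℝ]) + x.imK • ((qi : ℍ[ℝ]) * qj) := by
  ext <;> simp

/-- A commuting map commutes with left and right multiplication by i. These agree on ℂ and are
opposite on ℂj, so both lines are preserved and the map is a complex scalar on each. -/
theorem Admissible.absolutelyIrreducible {m : ℕ} (hm : 3 ≤ m)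
    {G : Subgroup (ℍ[ℝ] ≃ₗᵢ[ℝ] ℍ[ℝ])} (hG : Admissible m G) : AbsolutelyIrreducible G := by
  intro A hA
  have hs := sin_pi_div_ne_zero hm
  have hleft : ∀ x, A ((qi : ℍ[ℝ]) * x) = qi * A x := by
    intro x
    have h := hA _ hG.rot_e x
    -- `[e_m, 1]` is cos − sin · (left multiplication by i); as the sine is nonzero, commuting with
    -- it means commuting with i.
    have h1 : ∀ y, rot (qe m) 1 y
        = Real.cos (Real.pi / m) • y - Real.sin (Real.pi / m) • ((qi : ℍ[ℝ]) * y) := by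
      intro y; rw [rot_apply]; ext <;> simp [sub_eq_add_neg]
    rw [h1, h1, map_sub, map_smul, map_smul, sub_right_inj] at h
    exact smul_right_injective _ hs h
  have hright : ∀ x, A (x * (qi : ℍ[ℝ])) = A x * qi := by
    intro x
    have h := hA _ hG.rot_i x
    simpa only [rot_apply, OneMemClass.coe_one, star_one, one_mul] using h
  have h1 : InC (A 1) := by
    have h : (qi : ℍ[ℝ]) * A 1 = A 1 * qi := by rw [← hleft, ← hright, mul_one, one_mul]
    have hJ := congrArg (·.imJ) h
    have hK := congrArg (·.imK) h
    simp at hJ hK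
    constructor <;> linarith
  have hj : InCj (A qj) := by
    have h : (qi : ℍ[ℝ]) * A qj = - (A qj * qi) := by
      rw [← hleft, ← hright, ← map_neg]
      congr 1
      ext <;> simp
    have hJ := congrArg (·.re) h
    have hK := congrArg (·.imI) h
    simp at hJ hK
    constructor <;> linarith
  have hbasis : ∀ x, A x = x.re • A 1 + x.imI • (qi * A 1) + x.imJ • A qj
      + x.imK • (qi * A qj) := by
    intro x
    conv_lhs => rw [quaternion_eq_basis x]
    simp only [map_add, map_smul, hleft]
    congr 3
    conv_lhs => rw [← mul_one (qi : ℍ[ℝ]), hleft]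
  -- `[l, r]` with l, r ∈ ℂj is conjugate-linear on ℂ, so the scalar on ℂ equals its own conjugate.
  have him : (A 1).imI = 0 := by
    obtain ⟨l, r, hl, hr, hg⟩ := hG.exists_diag
    have h := hA _ hg 1
    have nl := sq_sum_of_unitary l
    have nr := sq_sum_of_unitary r
    rw [hbasis] at h
    simp only [rot_apply] at h
    have e1 := congrArg (·.re) h
    have e2 := congrArg (·.imI) h
    simp [hl.1, hl.2, hr.1, hr.2, h1.1, h1.2] at e1 e2 nl nr
    generalize (l : ℍ[ℝ]) = l at *
    generalize (r : ℍ[ℝ]) = r at *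
    linear_combination (-(-(l.imJ * r.imK) + l.imK * r.imJ) / 2) * e1
      + ((l.imJ * r.imJ + l.imK * r.imK) / 2) * e2
      - (A 1).imI * (r.imJ ^ 2 + r.imK ^ 2) * nl - (A 1).imI * nr
  -- The element exchanging ℂ and ℂj carries the real scalar on ℂ over to ℂj.
  have hb1 : (A qj).imJ = (A 1).re ∧ (A qj).imK = 0 := by
    obtain ⟨l, r, hl, hr, hg⟩ := hG.exists_swap
    have h := hA _ hg 1
    have nl := sq_sum_of_unitary l
    have nr := sq_sum_of_unitary r
    rw [hbasis] at h
    simp only [rot_apply] at h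
    have e1 := congrArg (·.imJ) h
    have e2 := congrArg (·.imK) h
    simp [hl.1, hl.2, hr.1, hr.2, h1.1, h1.2, him] at e1 e2 nl nr
    generalize (l : ℍ[ℝ]) = l at *
    generalize (r : ℍ[ℝ]) = r at *
    constructor
    · linear_combination (-(l.imJ * r.re) - l.imK * r.imI) * e1
        + (l.imJ * r.imI - l.imK * r.re) * e2
        - ((A qj).imJ - (A 1).re) * ((r.re ^ 2 + r.imI ^ 2) * nl + nr)
    · linear_combination -(l.imJ * r.imI - l.imK * r.re) * e1
        + (-(l.imJ * r.re) - l.imK * r.imI) * e2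
        - (A qj).imK * ((r.re ^ 2 + r.imI ^ 2) * nl + nr)
  refine ⟨(A 1).re, fun x => ?_⟩
  rw [hbasis]
  ext <;> simp [h1.1, h1.2, hj.1, hj.2, him, hb1.1, hb1.2, mul_comm]

end Algebra

/-! ### Taylor expansion of an equivariant family. -/

section Expansion

/-- Serves to cancel a power of t for t ≠ 0 and then evaluate the quotient at t = 0. -/
theorem eq_at_zero_of_continuous {E' : Type*} [TopologicalSpace E'] [T2Space E'] {f g : ℝ → E'}
    (hf : Continuous f) (hg : Continuous g) (h : ∀ t ≠ 0, f t = g t) : f 0 = g 0 :=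
  congrFun (hf.ext_on (dense_compl_singleton (0 : ℝ)) hg fun t ht => h t ht) 0

theorem eq_zero_of_eq_neg {E : Type*} [AddCommGroup E] [Module ℝ E] {x : E} (h : x = -x) :
    x = 0 := by
  have h2 : (2 : ℝ) • x = 0 := by
    rw [two_smul]
    exact add_eq_zero_iff_eq_neg.2 h
  exact (smul_eq_zero.1 h2).resolve_left two_ne_zero

theorem hasFDerivAt_apply_self {E E' : Type*} [NormedAddCommGroup E] [NormedSpace ℝ E]
    [NormedAddCommGroup E'] [NormedSpace ℝ E'] {A : E → E →L[ℝ] E'} (hA : ContDiff ℝ ∞ A) :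
    HasFDerivAt (fun x => A x x) (A 0) 0 := by
  have h := ((hA.differentiable (by simp)) 0).hasFDerivAt.clm_apply (hasFDerivAt_id (0 : E))
  have e : A 0 ∘L ContinuousLinearMap.id ℝ E + (fderiv ℝ A 0).flip (id 0) = A 0 := by
    ext v
    simp
  rw [e] at h
  exact h

variable {G : Subgroup (ℍ[ℝ] ≃ₗᵢ[ℝ] ℍ[ℝ])}

namespace BifurcationProblem

theorem map_neg (hi : rot 1 qi ∈ G) (F : BifurcationProblem G) (x : ℍ[ℝ]) (p : ℝ) :
    F.toFun (-x, p) = -F.toFun (x, p) := by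
  have h : ∀ y, (rot 1 qi * rot 1 qi) y = -y := by
    intro y
    rw [rot_mul, rot_apply]
    ext <;> simp
  simpa only [h] using F.equivariant _ (mul_mem hi hi) x p

theorem map_zero (hi : rot 1 qi ∈ G) (F : BifurcationProblem G) (p : ℝ) :
    F.toFun (0, p) = 0 := by
  have h := F.map_neg hi 0 p
  rw [neg_zero] at h
  exact eq_zero_of_eq_neg h

-- Hadamard's lemma is applied once in p and three times in x. Criticality removes the linear term
-- at p = 0, and oddness removes the quadratic one.
set_option maxSynthPendingDepth 3 in
theorem exists_expansion (hirr : AbsolutelyIrreducible G) (hi : rot 1 qi ∈ G)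
    (F : BifurcationProblem G) :
    ∃ (B : ℍ[ℝ] × ℝ → ℍ[ℝ] →L[ℝ] ℍ[ℝ]) (T : ℍ[ℝ] → ℍ[ℝ] →L[ℝ] ℍ[ℝ] →L[ℝ] ℍ[ℝ] →L[ℝ] ℍ[ℝ]) (d : ℝ),
      ContDiff ℝ ∞ B ∧ ContDiff ℝ ∞ T ∧
      (∀ x p, F.toFun (x, p) = p • B (x, p) x + T x x x x) ∧
      (∀ y, B (0, 0) y = d • y) ∧
      (∀ g ∈ G, ∀ y, T 0 (g y) (g y) (g y) = g (T 0 y y y)) ∧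
      ∃ σ : ℝ → ℝ, (∀ p : ℝ, fderiv ℝ (fun x : ℍ[ℝ] => F.toFun (x, p)) 0
        = σ p • ContinuousLinearMap.id ℝ ℍ[ℝ]) ∧ HasDerivAt σ d 0 := by
  obtain ⟨A, hA, hFA⟩ := exists_contDiff_eq_add_apply F.smooth
  replace hFA : ∀ x p, F.toFun (x, p) = A (x, p) x := fun x p => by
    rw [hFA, F.map_zero hi, zero_add]
  obtain ⟨B, hB, hAB⟩ := exists_contDiff_eq_add_apply (E := ℝ) (P := ℍ[ℝ])
    (f := fun q => A (q.2, q.1)) (hA.comp (contDiff_snd.prodMk contDiff_fst))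
  obtain ⟨A₂, hA₂, hAA₂⟩ := exists_contDiff_eq_add_apply (E := ℍ[ℝ]) (P := ℝ)
    (f := fun q => A (q.1, 0)) (hA.comp (contDiff_fst.prodMk contDiff_const))
  obtain ⟨T, hT, hA₂T⟩ := exists_contDiff_eq_add_apply (E := ℍ[ℝ]) (P := ℝ)
    (f := fun q => A₂ (q.1, 0)) (hA₂.comp (contDiff_fst.prodMk contDiff_const))
  simp only at hAB hAA₂ hA₂T
  have hfd : ∀ p, HasFDerivAt (fun x => F.toFun (x, p)) (A (0, p)) 0 := fun p => by
    have h := hasFDerivAt_apply_self (A := fun x => A (x, p))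
      (hA.comp (contDiff_id.prodMk contDiff_const))
    simpa only [← hFA] using h
  have hA0 : A (0, 0) = 0 := by rw [← (hfd 0).fderiv, F.critical]
  -- The quadratic part is even and, since -1 acts, also odd. Only its diagonal values vanish; the
  -- bilinear map itself need not be zero.
  have hA₂0 : ∀ x, A₂ (0, 0) x x = 0 := by
    intro x
    have hc : Continuous fun t : ℝ => A₂ (t • x, 0) x x := by
      have := hA₂.continuous
      fun_prop
    have hF : ∀ t : ℝ, F.toFun (t • x, 0) = t ^ 2 • A₂ (t • x, 0) x x := by
      intro t
      rw [hFA, hAA₂ _ 0, hA0, zero_add]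
      simp [pow_two, smul_smul]
    have h := eq_at_zero_of_continuous hc (g := fun t => -A₂ ((-t) • x, 0) x x)
      (hc.comp continuous_neg).neg (fun t ht => by
        have h1 := F.map_neg hi (t • x) 0
        rw [← neg_smul, hF, hF, neg_sq, ← smul_neg] at h1
        rw [← neg_neg (A₂ (t • x, 0) x x),
          ← smul_right_injective _ (pow_ne_zero 2 ht) h1])
    simp only [neg_zero, zero_smul] at h
    exact eq_zero_of_eq_neg h
  have hAcomm : ∀ p, ∀ g ∈ G, ∀ y, A (0, p) (g y) = g (A (0, p) y) := by
    intro p g hg y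
    have hcA := hA.continuous
    have h := eq_at_zero_of_continuous (f := fun t : ℝ => A (t • g y, p) (g y))
      (g := fun t : ℝ => g (A (t • y, p) y)) (by fun_prop)
      (g.continuous.comp (by fun_prop)) (fun t ht => by
        have h1 := F.equivariant g hg (t • y) p
        rw [map_smul, hFA, hFA, map_smul, map_smul, map_smul] at h1
        exact smul_right_injective _ ht h1)
    simpa using h
  have hscal : ∀ p, ∃ c : ℝ, ∀ x, A (0, p) x = c • x := fun p =>
    hirr (A (0, p) : ℍ[ℝ] →ₗ[ℝ] ℍ[ℝ]) (hAcomm p)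
  choose σ hσ using hscal
  have hBσ : ∀ p x, p • B (p, 0) 1 x = σ p • x := by
    intro p x
    rw [← hσ, hAB, hA0, zero_add]
    conv_rhs => rw [← mul_one p, ← smul_eq_mul, map_smul]
    simp
  -- σ(p) = p·b(p) with b continuous, so b(0) is the derivative of σ at 0.
  set b : ℝ → ℝ := fun p => (B (p, 0) 1 1).re with hb
  have hσb : ∀ p, σ p = p * b p := by
    intro p
    have h := congrArg (·.re) (hBσ p 1)
    simpa [hb] using h.symm
  have hcB := hB.continuous
  have hcb : Continuous b := by
    exact Quaternion.continuous_re.comp (by fun_prop)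
  refine ⟨fun q => B (q.2, q.1) 1, fun x => T (x, 0), b 0, ?_, ?_, ?_, ?_, ?_, σ, ?_, ?_⟩
  · fun_prop
  · fun_prop
  · intro x p
    rw [hFA, hAB, hAA₂ _ 0, hA0, zero_add, hA₂T _ 0]
    conv_lhs => rw [← mul_one p, ← smul_eq_mul, map_smul]
    simp [hA₂0, add_comm]
  · intro y
    refine eq_at_zero_of_continuous (f := fun p => B (p, 0) 1 y) (g := fun p => b p • y)
      (by fun_prop) (by fun_prop) fun p hp => smul_right_injective _ hp ?_
    simp only [hBσ, hσb, smul_smul]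
  · intro g hg y
    have hcT := hT.continuous
    have hF : ∀ (t : ℝ) x, F.toFun (t • x, 0) = t ^ 3 • T (t • x, 0) x x x := by
      intro t x
      rw [hFA, hAA₂ _ 0, hA0, zero_add, hA₂T _ 0]
      simp [pow_succ, smul_smul, hA₂0, mul_assoc]
    have h := eq_at_zero_of_continuous (f := fun t : ℝ => T (t • g y, 0) (g y) (g y) (g y))
      (g := fun t : ℝ => g (T (t • y, 0) y y y)) (by fun_prop)
      (g.continuous.comp (by fun_prop)) (fun t ht => by
        have h1 := F.equivariant g hg (t • y) 0
        rw [map_smul, hF, hF, map_smul] at h1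
        exact smul_right_injective _ (pow_ne_zero 3 ht) h1)
    simpa using h
  · intro p
    rw [(hfd p).fderiv]
    ext1 x
    simp [hσ]
  · have h0 : σ 0 = 0 := by rw [hσb, zero_mul]
    rw [hasDerivAt_iff_tendsto_slope]
    refine (hcb.tendsto 0 |>.mono_left nhdsWithin_le_nhds).congr' ?_
    filter_upwards [self_mem_nhdsWithin] with p hp
    rw [slope_def_field, h0, hσb p, sub_zero, sub_zero, mul_div_cancel_left₀ _ hp]

end BifurcationProblem
end Expansion

/-! ### The fixed plane, and the cubic part on ℂ. -/

section Frame

theorem inner_eq (x y : ℍ[ℝ]) :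
    inner ℝ x y = x.re * y.re + x.imI * y.imI + x.imJ * y.imJ + x.imK * y.imK := by
  rw [Quaternion.inner_def]
  simp

/-- An orthonormal frame of the plane fixed by the involution `[l, r]`, `l, r ∈ ℂ j`, adapted to
the splitting `ℍ = ℂ ⊕ ℂ j`. -/
theorem exists_frame (l r : unitary ℍ[ℝ]) (hl : InCj (l : ℍ[ℝ])) (hr : InCj (r : ℍ[ℝ])) :
    ∃ u w : ℍ[ℝ], InC u ∧ InCj w ∧ inner ℝ u u = 1 ∧ inner ℝ w w = 1 ∧
      ∀ x, x + rot l r x = (2 * inner ℝ u x) • u + (2 * inner ℝ w x) • w := by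
  have nl := sq_sum_of_unitary l
  have nr := sq_sum_of_unitary r
  simp only [rot_apply, inner_eq]
  generalize (l : ℍ[ℝ]) = l at *
  generalize (r : ℍ[ℝ]) = r at *
  rw [hl.1, hl.2] at nl
  rw [hr.1, hr.2] at nr
  -- Write l = λj, r = μj. A unit z ∈ ℂ is fixed exactly when z² = λμ̄. Take such a square root z =
  -- a + bi and put c + di = λz̄; then λ = z(c + di) and μ = z̄(c + di).
  obtain ⟨a, b, c, d, nu, nw, h1, h2, h3, h4⟩ : ∃ a b c d : ℝ, a ^ 2 + b ^ 2 = 1 ∧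
      c ^ 2 + d ^ 2 = 1 ∧ l.imJ = a * c - b * d ∧ l.imK = a * d + b * c ∧
      r.imJ = a * c + b * d ∧ r.imK = a * d - b * c := by
    obtain ⟨z, hz⟩ := IsAlgClosed.exists_pow_nat_eq
      ((⟨l.imJ, l.imK⟩ : ℂ) * ⟨r.imJ, -r.imK⟩) two_pos
    have e1 := congrArg Complex.re hz
    have e2 := congrArg Complex.im hz
    simp [pow_two] at e1 e2
    have hn : (z.re ^ 2 + z.im ^ 2) ^ 2 = 1 := by
      have : (z.re ^ 2 + z.im ^ 2) ^ 2
          = (z.re * z.re - z.im * z.im) ^ 2 + (z.re * z.im + z.im * z.re) ^ 2 := by ring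
      rw [this, e1, e2]
      linear_combination (r.imJ ^ 2 + r.imK ^ 2) * nl + nr
    have hz1 : z.re ^ 2 + z.im ^ 2 = 1 := by
      nlinarith [sq_nonneg z.re, sq_nonneg z.im]
    refine ⟨z.re, z.im, l.imJ * z.re + l.imK * z.im, l.imK * z.re - l.imJ * z.im, hz1,
      ?_, ?_, ?_, ?_, ?_⟩
    · linear_combination (l.imJ ^ 2 + l.imK ^ 2) * hz1 + nl
    · linear_combination (-l.imJ) * hz1
    · linear_combination (-l.imK) * hz1
    · linear_combination (-l.imJ) * e1 - l.imK * e2 - r.imJ * nl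
    · linear_combination (-l.imK) * e1 + l.imJ * e2 - r.imK * nl
  obtain ⟨u, u0, u1, u2, u3⟩ : ∃ u : ℍ[ℝ], u.re = a ∧ u.imI = b ∧ u.imJ = 0 ∧ u.imK = 0 :=
    ⟨⟨a, b, 0, 0⟩, rfl, rfl, rfl, rfl⟩
  obtain ⟨w, w0, w1, w2, w3⟩ : ∃ w : ℍ[ℝ], w.re = 0 ∧ w.imI = 0 ∧ w.imJ = c ∧ w.imK = d :=
    ⟨⟨0, 0, c, d⟩, rfl, rfl, rfl, rfl⟩
  refine ⟨u, w, ⟨u2, u3⟩, ⟨w0, w1⟩, ?_, ?_, fun x => ?_⟩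
  · rw [u0, u1, u2, u3]; linear_combination nu
  · rw [w0, w1, w2, w3]; linear_combination nw
  · ext <;> simp [hl.1, hl.2, hr.1, hr.2, h1, h2, h3, h4, u0, u1, u2, u3, w0, w1, w2, w3]
    · linear_combination ((a ^ 2 - b ^ 2) * x.re + 2 * a * b * x.imI) * nw - x.re * nu
    · linear_combination (2 * a * b * x.re - (a ^ 2 - b ^ 2) * x.imI) * nw - x.imI * nu
    · linear_combination ((c ^ 2 - d ^ 2) * x.imJ + 2 * c * d * x.imK) * nu - x.imJ * nw
    · linear_combination (2 * c * d * x.imJ - (c ^ 2 - d ^ 2) * x.imK) * nu - x.imK * nw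

theorem trilinear_expand {E E' : Type*} [NormedAddCommGroup E] [NormedSpace ℝ E]
    [NormedAddCommGroup E'] [NormedSpace ℝ E'] (T : E →L[ℝ] E →L[ℝ] E →L[ℝ] E') (u v : E)
    (x y : ℝ) :
    T (x • u + y • v) (x • u + y • v) (x • u + y • v)
      = x ^ 3 • T u u u + (x ^ 2 * y) • (T u u v + T u v u + T v u u)
        + (x * y ^ 2) • (T u v v + T v u v + T v v u) + y ^ 3 • T v v v := by
  simp only [map_add, map_smul, add_apply, smul_apply]
  module

/-- The hypothesis compares a cubic form at (c, s) and at (1, 0). Modulo c² + s² = 1 the difference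
is divisible by -is(c + is), which is nonzero. -/
theorem cubic_form_relation {a₀ a₂ : ℂ} {c s : ℝ} (hcs : c ^ 2 + s ^ 2 = 1) (hs : s ≠ 0)
    (h : a₀ * c ^ 3 + -Complex.I * a₂ * (c ^ 2 * s) + a₂ * (c * s ^ 2) + -Complex.I * a₀ * s ^ 3
      = (c + Complex.I * s) * a₀) :
    a₀ * (c - 2 * Complex.I * s) + a₂ * c = 0 := by
  have hcs' : (c : ℂ) ^ 2 + (s : ℂ) ^ 2 = 1 := by exact_mod_cast hcs
  have hne : (c : ℂ) + Complex.I * s ≠ 0 := by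
    intro h0
    have h1 : ((c : ℂ) + Complex.I * s) * (c - Complex.I * s) = 1 := by
      linear_combination hcs' - (s : ℂ) ^ 2 * Complex.I_sq
    rw [h0, zero_mul] at h1
    exact zero_ne_one h1
  have hs' : (s : ℂ) ≠ 0 := by exact_mod_cast hs
  have h2 : (s * -Complex.I * (c + Complex.I * s)) * (a₀ * (c - 2 * Complex.I * s) + a₂ * c) = 0 := by
    linear_combination h - a₀ * (c + Complex.I * s) * hcs'
      + (a₀ * c * s ^ 2 - a₂ * c * s ^ 2 + 2 * a₀ * s ^ 3 * Complex.I) * Complex.I_sq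
  refine (mul_eq_zero.1 h2).resolve_left (mul_ne_zero (mul_ne_zero hs' ?_) hne)
  exact neg_ne_zero.2 Complex.I_ne_zero

/-- The `ℂ j`-component of a quaternion. -/
def cjPart : ℍ[ℝ] →ₗ[ℝ] ℂ where
  toFun q := ⟨q.imJ, q.imK⟩
  map_add' _ _ := rfl
  map_smul' c q := by apply Complex.ext <;> simp

theorem cjPart_re (q : ℍ[ℝ]) : (cjPart q).re = q.imJ := rfl

theorem cjPart_im (q : ℍ[ℝ]) : (cjPart q).im = q.imK := rfl

theorem cjPart_eq_zero {q : ℍ[ℝ]} : cjPart q = 0 ↔ InC q := Complex.ext_iff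

theorem cjPart_mul_qi (q : ℍ[ℝ]) : cjPart (q * qi) = -Complex.I * cjPart q := by
  apply Complex.ext <;> simp [cjPart_re, cjPart_im]

theorem cjPart_star_qe_mul (m : ℕ) (q : ℍ[ℝ]) : cjPart (star (qe m : ℍ[ℝ]) * q)
    = (Real.cos (Real.pi / m) - Complex.I * Real.sin (Real.pi / m)) * cjPart q := by
  apply Complex.ext <;> simp [-Complex.ofReal_cos, -Complex.ofReal_sin, cjPart_re, cjPart_im]

theorem sin_two_pi_div_ne_zero {m : ℕ} (hm : 3 ≤ m) : Real.sin (2 * (Real.pi / m)) ≠ 0 := by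
  have h : (3 : ℝ) ≤ m := by exact_mod_cast hm
  refine (Real.sin_pos_of_pos_of_lt_pi (by positivity) ?_).ne'
  rw [← mul_div_assoc, div_lt_iff₀ (by linarith)]
  nlinarith [Real.pi_pos]

/-- A cubic map which commutes with `[e_m, 1]` and `[1, i]` preserves the line `ℂ`. -/
theorem inC_cubic_of_equivariant {m : ℕ} (hm : 3 ≤ m)
    (T : ℍ[ℝ] →L[ℝ] ℍ[ℝ] →L[ℝ] ℍ[ℝ] →L[ℝ] ℍ[ℝ])
    (he : ∀ y, T (rot (qe m) 1 y) (rot (qe m) 1 y) (rot (qe m) 1 y) = rot (qe m) 1 (T y y y))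
    (hi : ∀ y, T (rot 1 qi y) (rot 1 qi y) (rot 1 qi y) = rot 1 qi (T y y y))
    {u : ℍ[ℝ]} (hu : InC u) : InC (T u u u) := by
  rw [← cjPart_eq_zero]
  obtain ⟨v, rfl⟩ : ∃ v, v = u * qi := ⟨_, rfl⟩
  set v := u * (qi : ℍ[ℝ]) with hv
  set c := Real.cos (Real.pi / m) with hc
  set s := -Real.sin (Real.pi / m) with hs
  have hcs : c ^ 2 + s ^ 2 = 1 := by rw [hc, hs, neg_sq, Real.cos_sq_add_sin_sq]
  have r1 : ∀ x y : ℝ, rot 1 qi (x • u + y • v) = (-y) • u + x • v := by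
    intro x y
    rw [rot_apply]
    ext <;> simp [hv] <;> ring
  have r2 : ∀ x y : ℝ, rot (qe m) 1 (x • u + y • v)
      = (c * x - s * y) • u + (s * x + c * y) • v := by
    intro x y
    rw [rot_apply]
    ext <;> simp [hv, hu.1, hu.2, hc, hs] <;> ring
  -- In terms of z = x + iy this cubic form satisfies q(iz) = -i·q(z), which leaves only z³ and
  -- z·z̄². Then q(ζz) = ζ·q(z) with ζ = e^{-iπ/m} would require ζ² = 1 for either monomial. The
  -- argument below carries this out in real coordinates.
  set q : ℝ → ℝ → ℂ := fun x y =>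
    cjPart (T (x • u + y • v) (x • u + y • v) (x • u + y • v)) with hq
  have q1 : ∀ x y : ℝ, q (-y) x = -Complex.I * q x y := by
    intro x y
    simp only [hq]
    rw [← cjPart_mul_qi, ← r1, hi, rot_apply]
    simp
  have q2 : ∀ x y : ℝ, q (c * x - s * y) (s * x + c * y) = (c + Complex.I * s) * q x y := by
    intro x y
    simp only [hq]
    rw [← r2, he, rot_apply, OneMemClass.coe_one, mul_one, cjPart_star_qe_mul]
    push_cast [hc, hs]
    ring
  obtain ⟨a₁, a₂, a₃, hqa⟩ : ∃ a₁ a₂ a₃ : ℂ, ∀ x y : ℝ, q x y = x ^ 3 * cjPart (T u u u)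
      + x ^ 2 * y * a₁ + x * y ^ 2 * a₂ + y ^ 3 * a₃ := by
    refine ⟨cjPart (T u u v + T u v u + T v u u), cjPart (T u v v + T v u v + T v v u),
      cjPart (T v v v), fun x y => (congrArg cjPart (trilinear_expand T u v x y)).trans ?_⟩
    simp only [map_add cjPart, map_smul cjPart, Complex.real_smul, Complex.ofReal_mul,
      Complex.ofReal_pow]
  generalize cjPart (T u u u) = a₀ at *
  have e0 := q1 1 0
  have e1 := q1 1 1
  have e2 := q2 1 0
  have e3 := q2 c s
  rw [show c * 1 - s * 0 = c by ring, show s * 1 + c * 0 = s by ring] at e2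
  rw [e2, hqa, hqa] at e3
  rw [hqa, hqa] at e0 e1 e2
  push_cast at e0 e1 e2 e3
  have ha₃ : a₃ = -Complex.I * a₀ := by linear_combination e0
  have ha₁ : a₁ = -Complex.I * a₂ := by
    rw [ha₃] at e1
    linear_combination (1 - Complex.I) / 2 * e1
      + (a₀ - a₀ * Complex.I + a₁ + a₂) / 2 * Complex.I_sq
  have hs0 : s ≠ 0 := neg_ne_zero.2 (sin_pi_div_ne_zero hm)
  have hsc0 : 2 * c * s ≠ 0 := by
    have h := sin_two_pi_div_ne_zero hm
    rw [Real.sin_two_mul] at h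
    rw [hs]
    intro h0
    exact h (by linarith)
  -- The relation at the angle -π/m and at its double: eliminating a₂ leaves a nonzero multiple of
  -- sin(π/m)·a₀.
  have k1 := cubic_form_relation (a₀ := a₀) (a₂ := a₂) hcs hs0 (by
    rw [ha₁, ha₃] at e2
    linear_combination e2)
  have k2 := cubic_form_relation (a₀ := a₀) (a₂ := a₂) (c := c ^ 2 - s ^ 2) (s := 2 * c * s)
    (by linear_combination (c ^ 2 + s ^ 2 + 1) * hcs) hsc0 (by
    rw [ha₁, ha₃] at e3
    push_cast
    linear_combination e3 + a₀ * s ^ 2 * Complex.I_sq)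
  push_cast at k2
  have hcs' : (c : ℂ) ^ 2 + (s : ℂ) ^ 2 = 1 := by exact_mod_cast hcs
  have k3 : (-2 * Complex.I * s) * a₀ = 0 := by
    linear_combination c * k2 - (c ^ 2 - s ^ 2) * k1 + 2 * Complex.I * s * a₀ * hcs'
  refine (mul_eq_zero.1 k3).resolve_left (mul_ne_zero (by simp) (by exact_mod_cast hs0))

end Frame

/-! ### Construction of the branch by rescaling and the implicit function theorem. -/

section Branch

theorem isInvertible_of_triangular (L : ℝ × ℝ →L[ℝ] ℝ × ℝ) {a b c : ℝ} (ha : a ≠ 0) (hc : c ≠ 0)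
    (h1 : L (1, 0) = (a, 0)) (h2 : L (0, 1) = (b, c)) : L.IsInvertible := by
  have hL : ∀ x : ℝ × ℝ, L x = (x.1 * a + x.2 * b, x.2 * c) := by
    intro x
    have hx : x = x.1 • ((1, 0) : ℝ × ℝ) + x.2 • ((0, 1) : ℝ × ℝ) := by simp
    conv_lhs => rw [hx, map_add, map_smul, map_smul, h1, h2]
    simp
  have hinj : Function.Injective (L : ℝ × ℝ →ₗ[ℝ] ℝ × ℝ) := by
    rw [injective_iff_map_eq_zero]
    intro x hx
    have hx' : L x = 0 := hx
    rw [hL, Prod.mk_eq_zero] at hx'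
    have e2 := (mul_eq_zero.1 hx'.2).resolve_right hc
    rw [e2, zero_mul, add_zero] at hx'
    exact Prod.ext ((mul_eq_zero.1 hx'.1).resolve_right ha) e2
  refine ⟨(LinearEquiv.ofInjectiveEndo _ hinj).toContinuousLinearEquiv, ?_⟩
  ext <;> rfl

/-- A continuous solution branch of a planar equation with triangular nondegenerate linearisation. -/
theorem exists_continuous_branch {Ψ : ℝ × (ℝ × ℝ) → ℝ × ℝ} (hΨ : ContDiff ℝ ∞ Ψ) {ρ a b c : ℝ}
    (h0 : Ψ (0, (ρ, 0)) = 0) (ha : a ≠ 0) (hc : c ≠ 0) (hρ : ρ ≠ 0)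
    (h1 : HasDerivAt (fun x => Ψ (0, (x, 0))) (a, 0) ρ)
    (h2 : HasDerivAt (fun y => Ψ (0, (ρ, y))) (b, c) 0) :
    ∃ (δ : ℝ) (ψ : ℝ → ℝ × ℝ), 0 < δ ∧ ∀ t, |t| < δ →
      ContinuousAt ψ t ∧ Ψ (t, ψ t) = 0 ∧ (ψ t).1 ≠ 0 := by
  have hd := (hΨ.differentiable (by simp) (0, (ρ, 0))).hasFDerivAt
  have hinv : (fderiv ℝ Ψ (0, (ρ, 0)) ∘L .inr ℝ ℝ (ℝ × ℝ)).IsInvertible := by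
    refine isInvertible_of_triangular (b := b) _ ha hc ?_ ?_
    · have h := hd.comp_hasDerivAt ρ (f := fun x : ℝ => ((0 : ℝ), (x, (0 : ℝ))))
        ((hasDerivAt_const ρ (0 : ℝ)).prodMk ((hasDerivAt_id ρ).prodMk (hasDerivAt_const ρ (0 : ℝ))))
      exact h.unique h1
    · have h := hd.comp_hasDerivAt 0 (f := fun y : ℝ => ((0 : ℝ), (ρ, y)))
        ((hasDerivAt_const 0 (0 : ℝ)).prodMk ((hasDerivAt_const 0 ρ).prodMk (hasDerivAt_id 0)))
      exact h.unique h2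
  have hcd : ContDiffAt ℝ 1 Ψ (0, (ρ, 0)) := (hΨ.of_le (by exact_mod_cast le_top)).contDiffAt
  set ψ := hcd.implicitFunction one_ne_zero hinv with hψ
  have hψc : ContDiffAt ℝ 1 ψ 0 := hcd.contDiffAt_implicitFunction one_ne_zero hinv
  have hψ0 : ψ 0 = (ρ, 0) := hcd.implicitFunction_apply_self one_ne_zero hinv
  have e1 : ∀ᶠ t in 𝓝 (0 : ℝ), ContinuousAt ψ t :=
    (hψc.eventually (by simp)).mono fun t ht => ht.continuousAt
  have e2 : ∀ᶠ t in 𝓝 (0 : ℝ), Ψ (t, ψ t) = Ψ (0, (ρ, 0)) :=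
    hcd.eventually_apply_implicitFunction one_ne_zero hinv
  have e3 : ∀ᶠ t in 𝓝 (0 : ℝ), (ψ t).1 ≠ 0 :=
    (continuous_fst.continuousAt.comp hψc.continuousAt).eventually_ne (by
      simpa only [Function.comp_apply, hψ0] using hρ)
  obtain ⟨δ, hδ, h⟩ := Metric.eventually_nhds_iff.1 (e1.and (e2.and e3))
  refine ⟨δ, ψ, hδ, fun t ht => ?_⟩
  obtain ⟨k1, k2, k3⟩ := h (y := t) (by rwa [Real.dist_0_eq_abs])
  exact ⟨k1, k2.trans h0, k3⟩

theorem hasDerivAt_cubic {f : ℝ → ℝ} {f' x : ℝ} (k₀ k₁ k₂ k₃ : ℝ)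
    (hf : ∀ x, f x = k₀ + k₁ * x + k₂ * x ^ 2 + k₃ * x ^ 3)
    (hf' : f' = k₁ + 2 * k₂ * x + 3 * k₃ * x ^ 2) : HasDerivAt f f' x := by
  have h := ((((hasDerivAt_id' x).const_mul k₁).const_add k₀).add
    ((hasDerivAt_pow 2 x).const_mul k₂)).add ((hasDerivAt_pow 3 x).const_mul k₃)
  refine (h.congr_of_eventuallyEq (Eventually.of_forall hf)).congr_deriv ?_
  rw [hf']
  push_cast
  ring

set_option maxSynthPendingDepth 3 in
/-- Bifurcation in a plane spanned by an orthonormal pair `u`, `w`, of a family with cubic leading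
part `T` that has the nondegenerate direction `u`. -/
theorem exists_branch_of_nondegenerate {F : ℍ[ℝ] × ℝ → ℍ[ℝ]} {B : ℍ[ℝ] × ℝ → ℍ[ℝ] →L[ℝ] ℍ[ℝ]}
    {T : ℍ[ℝ] → ℍ[ℝ] →L[ℝ] ℍ[ℝ] →L[ℝ] ℍ[ℝ] →L[ℝ] ℍ[ℝ]} {d : ℝ} (hB : ContDiff ℝ ∞ B)
    (hT : ContDiff ℝ ∞ T) (hF : ∀ x p, F (x, p) = p • B (x, p) x + T x x x x)
    (hB0 : ∀ y, B (0, 0) y = d • y) {u w : ℍ[ℝ]} (huu : inner ℝ u u = (1 : ℝ))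
    (hww : inner ℝ w w = (1 : ℝ)) (huw : inner ℝ u w = (0 : ℝ))
    (hV : ∀ (a b p : ℝ), inner ℝ u (F (a • u + b • w, p)) = (0 : ℝ) →
      inner ℝ w (F (a • u + b • w, p)) = (0 : ℝ) → F (a • u + b • w, p) = 0)
    {α β : ℝ} (hα : inner ℝ u (T 0 u u u) = α) (hwu : inner ℝ w (T 0 u u u) = (0 : ℝ))
    (hβ : inner ℝ w (T 0 u u w + T 0 u w u + T 0 w u u) = β)
    (hd : d ≠ 0) (hα0 : α ≠ 0) (hαβ : β - α ≠ 0) :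
    ∃ (ε : ℝ) (δ : ℝ) (x : ℝ → ℍ[ℝ]), (ε = 1 ∨ ε = -1) ∧ 0 < δ ∧
      ContinuousOn x (Set.Ico 0 δ) ∧ x 0 = 0 ∧
      ∀ s ∈ Set.Ioo 0 δ, x s ≠ 0 ∧ F (x s, ε * s) = 0 := by
  -- The side of p = 0 is chosen so that ρ² = -εd/α has a real solution.
  obtain ⟨ε, hε, hneg⟩ : ∃ ε : ℝ, (ε = 1 ∨ ε = -1) ∧ 0 < -(ε * d) / α := by
    rcases lt_or_gt_of_ne (div_ne_zero hd hα0) with h | h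
    · exact ⟨1, Or.inl rfl, by rw [one_mul, neg_div]; linarith⟩
    · exact ⟨-1, Or.inr rfl, by rw [neg_one_mul, neg_neg]; exact h⟩
  set ρ := Real.sqrt (-(ε * d) / α) with hρ
  have hρ0 : ρ ≠ 0 := (Real.sqrt_pos.2 hneg).ne'
  have hρ2 : ε * d = -(ρ ^ 2 * α) := by
    rw [hρ, Real.sq_sqrt hneg.le]
    field_simp
  -- With x = t(au + bw) and p = εt², F(x, p) = t³·K(t, (a, b)), and K is smooth up to t = 0.
  set K : ℝ × (ℝ × ℝ) → ℍ[ℝ] := fun q =>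
    ε • B (q.1 • (q.2.1 • u + q.2.2 • w), ε * q.1 ^ 2) (q.2.1 • u + q.2.2 • w)
      + T (q.1 • (q.2.1 • u + q.2.2 • w)) (q.2.1 • u + q.2.2 • w) (q.2.1 • u + q.2.2 • w)
        (q.2.1 • u + q.2.2 • w) with hK
  have hKc : ContDiff ℝ ∞ K := by fun_prop
  have hK0 : ∀ a b, K (0, (a, b)) = (ε * d) • (a • u + b • w)
      + (a ^ 3 • T 0 u u u + (a ^ 2 * b) • (T 0 u u w + T 0 u w u + T 0 w u u)
        + (a * b ^ 2) • (T 0 u w w + T 0 w u w + T 0 w w u) + b ^ 3 • T 0 w w w) := by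
    intro a b
    rw [← trilinear_expand]
    simp only [hK, zero_smul, ne_eq, OfNat.ofNat_ne_zero, not_false_eq_true, zero_pow, mul_zero,
      hB0, mul_smul]
  set Ψ : ℝ × (ℝ × ℝ) → ℝ × ℝ := fun q => (inner ℝ u (K q), inner ℝ w (K q)) with hΨ
  have hΨc : ContDiff ℝ ∞ Ψ :=
    (contDiff_const.inner ℝ hKc).prodMk (contDiff_const.inner ℝ hKc)
  have hwu' : inner ℝ w u = (0 : ℝ) := by rw [real_inner_comm, huw]
  have hΨ0 : ∀ a b, Ψ (0, (a, b)) =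
      (ε * d * a + a ^ 3 * α + a ^ 2 * b * inner ℝ u (T 0 u u w + T 0 u w u + T 0 w u u)
        + a * b ^ 2 * inner ℝ u (T 0 u w w + T 0 w u w + T 0 w w u)
        + b ^ 3 * inner ℝ u (T 0 w w w),
      ε * d * b + a ^ 2 * b * β + a * b ^ 2 * inner ℝ w (T 0 u w w + T 0 w u w + T 0 w w u)
        + b ^ 3 * inner ℝ w (T 0 w w w)) := by
    intro a b
    simp only [hΨ, hK0]
    generalize T 0 u u w + T 0 u w u + T 0 w u u = X at *
    generalize T 0 u w w + T 0 w u w + T 0 w w u = Y at *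
    simp only [inner_add_right, inner_smul_right, hα, hwu, hβ, huu, hww, huw, hwu']
    ext <;> simp <;> ring
  -- The linearisation at (ρ, 0) is triangular because the cubic part at u has no w-component.
  obtain ⟨δ, ψ, hδ, hψ⟩ := exists_continuous_branch hΨc (ρ := ρ) (a := 2 * ρ ^ 2 * α)
    (b := ρ ^ 2 * inner ℝ u (T 0 u u w + T 0 u w u + T 0 w u u)) (c := ρ ^ 2 * (β - α))
    (by
      rw [hΨ0, hρ2]
      ext <;> simp
      ring)
    (mul_ne_zero (mul_ne_zero two_ne_zero (pow_ne_zero 2 hρ0)) hα0)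
    (mul_ne_zero (pow_ne_zero 2 hρ0) hαβ) hρ0
    (by
      simp only [hΨ0]
      refine HasDerivAt.prodMk ?_ ?_
      · exact hasDerivAt_cubic 0 (ε * d) 0 α (fun _ => by ring) (by rw [hρ2]; ring)
      · exact hasDerivAt_cubic 0 0 0 0 (fun _ => by ring) (by ring))
    (by
      simp only [hΨ0]
      refine HasDerivAt.prodMk ?_ ?_
      · exact hasDerivAt_cubic (ε * d * ρ + ρ ^ 3 * α)
          (ρ ^ 2 * inner ℝ u (T 0 u u w + T 0 u w u + T 0 w u u))
          (ρ * inner ℝ u (T 0 u w w + T 0 w u w + T 0 w w u)) (inner ℝ u (T 0 w w w))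
          (fun _ => by ring) (by ring)
      · exact hasDerivAt_cubic 0 (ε * d + ρ ^ 2 * β)
          (ρ * inner ℝ w (T 0 u w w + T 0 w u w + T 0 w w u)) (inner ℝ w (T 0 w w w))
          (fun _ => by ring) (by rw [hρ2]; ring))
  -- The scaling parameter is t = √s, which gives p = εs.
  refine ⟨ε, δ ^ 2, fun s => √s • ((ψ √s).1 • u + (ψ √s).2 • w), hε, by positivity, ?_, by simp, ?_⟩
  · intro s hs
    have ht : |√s| < δ := by
      rw [abs_of_nonneg (Real.sqrt_nonneg s)]
      exact (Real.sqrt_lt' hδ).2 hs.2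
    have hc : ContinuousAt (fun s => ψ √s) s :=
      ContinuousAt.comp (f := Real.sqrt) (g := ψ) (hψ _ ht).1 Real.continuous_sqrt.continuousAt
    refine ContinuousAt.continuousWithinAt ?_
    have hs' : ContinuousAt Real.sqrt s := Real.continuous_sqrt.continuousAt
    exact hs'.smul ((hc.fst.smul continuousAt_const).add (hc.snd.smul continuousAt_const))
  · intro s hs
    have ht : |√s| < δ := by
      rw [abs_of_nonneg (Real.sqrt_nonneg s)]
      exact (Real.sqrt_lt' hδ).2 hs.2
    obtain ⟨-, h2, h3⟩ := hψ _ ht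
    have hs2 : s = √s ^ 2 := (Real.sq_sqrt hs.1.le).symm
    have hs0 : √s ≠ 0 := (Real.sqrt_pos.2 hs.1).ne'
    have hKF : F (√s • ((ψ √s).1 • u + (ψ √s).2 • w), ε * s) = √s ^ 3 • K (√s, ψ √s) := by
      have e : ε * s = ε * √s ^ 2 := by rw [← hs2]
      rw [e, hF]
      simp only [hK, map_smul, smul_apply]
      module
    rw [hΨ] at h2
    simp only [Prod.mk_eq_zero] at h2
    constructor
    · refine smul_ne_zero hs0 fun h => h3 ?_
      have h' := congrArg (fun y => (inner ℝ u y : ℝ)) h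
      simpa only [inner_add_right, inner_smul_right, huu, huw, inner_zero_right, mul_one, mul_zero,
        add_zero] using h'
    · have hV' := hV (√s * (ψ √s).1) (√s * (ψ √s).2) (ε * s)
      rw [mul_smul, mul_smul, ← smul_add, hKF, inner_smul_right, inner_smul_right, h2.1, h2.2,
        mul_zero] at hV'
      simp only
      rw [hKF]
      exact hV' rfl rfl

end Branch

/-! ### Jets at the origin and compactly supported equivariant perturbations. -/

section Genericity

variable {G : Subgroup (ℍ[ℝ] ≃ₗᵢ[ℝ] ℍ[ℝ])}

namespace BifurcationProblem

/-- A component of the `n`-th derivative at the origin in a single direction `v`. -/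
noncomputable def jet (n : ℕ) (v : ℍ[ℝ] × ℝ) (y : ℍ[ℝ]) (F : BifurcationProblem G) : ℝ :=
  inner ℝ y (iteratedFDeriv ℝ n F.toFun 0 fun _ => v)

theorem jet_eq_of_pow (F : BifurcationProblem G) (n : ℕ) (v : ℍ[ℝ] × ℝ) (y : ℍ[ℝ]) {m : ℝ → ℍ[ℝ]}
    (hm : ContDiff ℝ ∞ m) (h : ∀ t : ℝ, F.toFun (t • v) = t ^ n • m t) :
    F.jet n v y = n.factorial * inner ℝ y (m 0) := by
  rw [jet, iteratedFDeriv_zero_apply_of_pow F.smooth v n hm h, inner_smul_right]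

theorem continuous_jet (n : ℕ) (v : ℍ[ℝ] × ℝ) (y : ℍ[ℝ]) :
    @Continuous _ _ (weakTopology G) _ (jet n v y : BifurcationProblem G → ℝ) := by
  let _ := weakTopology G
  refine continuous_def.2 fun V hV F hF => ?_
  obtain ⟨η, hη, hball⟩ := Metric.isOpen_iff.1 hV _ hF
  -- The summand 1 covers the case where y or v vanishes.
  have hC : 0 < ‖y‖ * ‖v‖ ^ n + 1 := by positivity
  refine ⟨{0}, n, η / (‖y‖ * ‖v‖ ^ n + 1), isCompact_singleton, by positivity, fun H hH => hball ?_⟩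
  have h := hH 0 rfl n le_rfl
  rw [Metric.mem_ball, Real.dist_eq, jet, jet, ← inner_sub_right,
    ← sub_apply]
  have h1 := (iteratedFDeriv ℝ n H.toFun 0 - iteratedFDeriv ℝ n F.toFun 0).le_opNorm fun _ => v
  rw [Finset.prod_const, Finset.card_univ, Fintype.card_fin] at h1
  calc _ ≤ ‖y‖ * _ := abs_real_inner_le_norm _ _
    _ ≤ ‖y‖ * (‖iteratedFDeriv ℝ n H.toFun 0 - iteratedFDeriv ℝ n F.toFun 0‖ * ‖v‖ ^ n) := by
      gcongr
    _ = (‖y‖ * ‖v‖ ^ n) * ‖iteratedFDeriv ℝ n H.toFun 0 - iteratedFDeriv ℝ n F.toFun 0‖ := by ring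
    _ ≤ (‖y‖ * ‖v‖ ^ n) * (η / (‖y‖ * ‖v‖ ^ n + 1)) := by gcongr
    _ < (‖y‖ * ‖v‖ ^ n + 1) * (η / (‖y‖ * ‖v‖ ^ n + 1)) := by gcongr; linarith
    _ = η := by field_simp

theorem isOpen_whitney_of_weak {U : Set (BifurcationProblem G)} (h : IsOpen[weakTopology G] U) :
    IsOpen[whitneyTopology G] U := by
  intro F hF
  obtain ⟨K, k, ε, -, hε, hU⟩ := h F hF
  exact ⟨k, fun _ => ε, continuous_const, fun _ => hε,
    fun H hH => hU fun q _ i hi => hH q (Set.mem_univ q) i hi⟩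

/-- The perturbation `F + c R`. -/
noncomputable def addSMul (F : BifurcationProblem G) (c : ℝ) (R : BifurcationProblem G) :
    BifurcationProblem G where
  toFun q := F.toFun q + c • R.toFun q
  smooth := F.smooth.add (R.smooth.const_smul c)
  equivariant g hg x p := by rw [F.equivariant g hg, R.equivariant g hg, map_add, map_smul]
  critical := by
    have hx : ContDiff ℝ ∞ fun x : ℍ[ℝ] => (x, (0 : ℝ)) := by fun_prop
    have h1 : DifferentiableAt ℝ (fun x : ℍ[ℝ] => F.toFun (x, 0)) 0 :=
      (F.smooth.comp hx).differentiable (by simp) 0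
    have h2 : DifferentiableAt ℝ (fun x : ℍ[ℝ] => R.toFun (x, 0)) 0 :=
      (R.smooth.comp hx).differentiable (by simp) 0
    have h := h1.hasFDerivAt.add (h2.hasFDerivAt.const_smul c)
    rw [F.critical, R.critical, smul_zero, add_zero] at h
    exact h.fderiv

theorem iteratedFDeriv_addSMul (F : BifurcationProblem G) (c : ℝ) (R : BifurcationProblem G) (n : ℕ)
    (q : ℍ[ℝ] × ℝ) : iteratedFDeriv ℝ n (F.addSMul c R).toFun q
      = iteratedFDeriv ℝ n F.toFun q + c • iteratedFDeriv ℝ n R.toFun q := by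
  have hF : ContDiffAt ℝ n F.toFun q := (F.smooth.of_le (by exact_mod_cast le_top)).contDiffAt
  have hR : ContDiffAt ℝ n R.toFun q := (R.smooth.of_le (by exact_mod_cast le_top)).contDiffAt
  rw [← iteratedFDeriv_const_smul_apply hR]
  exact iteratedFDeriv_add_apply hF (hR.const_smul c)

theorem jet_addSMul (n : ℕ) (v : ℍ[ℝ] × ℝ) (y : ℍ[ℝ]) (F : BifurcationProblem G) (c : ℝ)
    (R : BifurcationProblem G) : (F.addSMul c R).jet n v y = F.jet n v y + c * R.jet n v y := by
  simp only [jet, iteratedFDeriv_addSMul, add_apply, smul_apply, inner_add_right, inner_smul_right]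

/-- On a compact support the positive function ε is bounded below, so each derivative of R is at
most a constant times ε, and a small c suffices for the finitely many orders involved. -/
theorem exists_forall_addSMul_mem {V : Set (BifurcationProblem G)}
    (hV : IsOpen[whitneyTopology G] V) {F R : BifurcationProblem G} (hF : F ∈ V)
    (hR : HasCompactSupport R.toFun) : ∃ c₀ > 0, ∀ c, 0 < c → c < c₀ → F.addSMul c R ∈ V := by
  obtain ⟨k, ε, hεc, hε, hV⟩ := hV F hF
  have hbd : ∀ i : ℕ, ∃ M, ∀ q, ‖iteratedFDeriv ℝ i R.toFun q‖ ≤ M * ε q := by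
    intro i
    have hd : Continuous (iteratedFDeriv ℝ i R.toFun) :=
      R.smooth.continuous_iteratedFDeriv (by exact_mod_cast le_top)
    have hc : Continuous fun q => (ε q)⁻¹ * ‖iteratedFDeriv ℝ i R.toFun q‖ :=
      (hεc.inv₀ fun q => (hε q).ne').mul hd.norm
    obtain ⟨M, hM⟩ := hc.bounded_above_of_compact_support (hR.iteratedFDeriv i).norm.mul_left
    refine ⟨M, fun q => ?_⟩
    have h := (le_abs_self _).trans (hM q)
    rwa [inv_mul_le_iff₀ (hε q), mul_comm] at h
  choose M hM using hbd
  set S := ∑ i ∈ Finset.range (k + 1), |M i| with hS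
  have hS0 : 0 ≤ S := Finset.sum_nonneg fun _ _ => abs_nonneg _
  refine ⟨(S + 1)⁻¹, by positivity, fun c hc hc' => hV fun q _ i hi => ?_⟩
  rw [iteratedFDeriv_addSMul, add_sub_cancel_left, norm_smul, Real.norm_of_nonneg hc.le]
  have hMi : M i ≤ S := (le_abs_self _).trans
    (Finset.single_le_sum (f := fun i => |M i|) (fun _ _ => abs_nonneg _)
      (Finset.mem_range.2 (Nat.lt_succ_of_le hi)))
  have hcS : c * (S + 1) < 1 := by
    rwa [lt_inv_comm₀ hc (by positivity), ← one_div, lt_div_iff₀' hc] at hc'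
  calc c * ‖iteratedFDeriv ℝ i R.toFun q‖ ≤ c * (S * ε q) := by
        gcongr
        exact (hM i q).trans (mul_le_mul_of_nonneg_right hMi (hε q).le)
    _ ≤ (c * (S + 1)) * ε q := by nlinarith [hε q, mul_pos hc (hε q)]
    _ < 1 * ε q := by gcongr; exact hε q
    _ = ε q := one_mul _

end BifurcationProblem

theorem contDiff_of_isLinearMap {E' : Type*} [NormedAddCommGroup E'] [NormedSpace ℝ E']
    {f : ℍ[ℝ] → E'} (h : IsLinearMap ℝ f) : ContDiff ℝ ∞ f :=
  (LinearMap.toContinuousLinearMap (h.mk' f)).contDiff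

theorem contDiff_normSqDiff : ContDiff ℝ ∞ normSqDiff := by
  have h0 : ContDiff ℝ ∞ fun x : ℍ[ℝ] => x.re := contDiff_of_isLinearMap ⟨by simp, by simp⟩
  have h1 : ContDiff ℝ ∞ fun x : ℍ[ℝ] => x.imI := contDiff_of_isLinearMap ⟨by simp, by simp⟩
  have h2 : ContDiff ℝ ∞ fun x : ℍ[ℝ] => x.imJ := contDiff_of_isLinearMap ⟨by simp, by simp⟩
  have h3 : ContDiff ℝ ∞ fun x : ℍ[ℝ] => x.imK := contDiff_of_isLinearMap ⟨by simp, by simp⟩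
  exact (((h0.pow 2).add (h1.pow 2)).sub (h2.pow 2)).sub (h3.pow 2)

@[simp] theorem reflection_re (x : ℍ[ℝ]) : (reflection x).re = -x.re := rfl
@[simp] theorem reflection_imI (x : ℍ[ℝ]) : (reflection x).imI = -x.imI := rfl
@[simp] theorem reflection_imJ (x : ℍ[ℝ]) : (reflection x).imJ = x.imJ := rfl
@[simp] theorem reflection_imK (x : ℍ[ℝ]) : (reflection x).imK = x.imK := rfl

theorem contDiff_reflection : ContDiff ℝ ∞ reflection := by
  refine contDiff_of_isLinearMap ⟨fun x y => ?_, fun c x => ?_⟩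
  · ext <;> simp [add_comm]
  · ext <;> simp

theorem contDiff_cubic : ContDiff ℝ ∞ cubic := contDiff_normSqDiff.smul contDiff_reflection

theorem cubic_smul (t : ℝ) (x : ℍ[ℝ]) : cubic (t • x) = t ^ 3 • cubic x := by
  ext <;> simp [cubic_re, cubic_imI, cubic_imJ, cubic_imK] <;> ring

/-- A rotation invariant smooth cutoff function. -/
noncomputable def cutoff (q : ℍ[ℝ] × ℝ) : ℝ := Real.smoothTransition (2 - ‖q.1‖ ^ 2 - q.2 ^ 2)

theorem contDiff_cutoff : ContDiff ℝ ∞ cutoff := by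
  refine Real.smoothTransition.contDiff.comp ?_
  exact (contDiff_const.sub (contDiff_fst.norm_sq ℝ)).sub (contDiff_snd.pow 2)

theorem cutoff_zero : cutoff 0 = 1 := by
  apply Real.smoothTransition.one_of_one_le
  norm_num

/-- A compactly supported equivariant perturbation with prescribed low order terms. -/
noncomputable def bump {m : ℕ} (hG : Admissible m G) : BifurcationProblem G where
  toFun q := cutoff q • (q.2 • q.1 + cubic q.1)
  smooth := contDiff_cutoff.smul ((contDiff_snd.smul contDiff_fst).add
    (contDiff_cubic.comp contDiff_fst))
  equivariant g hg x p := by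
    simp only [cutoff, LinearIsometryEquiv.norm_map, hG.cubic_equivariant g hg, map_smul, map_add]
  critical := by
    have h1 : DifferentiableAt ℝ (fun x : ℍ[ℝ] => cutoff (x, 0) * normSqDiff x) 0 :=
      ((contDiff_cutoff.comp (contDiff_id.prodMk contDiff_const)).mul
        contDiff_normSqDiff).differentiable (by simp) 0
    have h2 : DifferentiableAt ℝ reflection 0 := contDiff_reflection.differentiable (by simp) 0
    have h := h1.hasFDerivAt.smul h2.hasFDerivAt
    have e : (fun x : ℍ[ℝ] => cutoff (x, 0) • ((0 : ℝ) • x + cubic x))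
        = (fun x : ℍ[ℝ] => cutoff (x, 0) * normSqDiff x) • reflection := by
      ext1 x
      simp [cubic, mul_smul]
    have e0 : normSqDiff 0 = 0 := by simp [normSqDiff]
    have e1 : reflection 0 = 0 := by ext <;> simp
    rw [← e, e0, e1] at h
    rw [h.fderiv]
    ext1 v
    simp

theorem hasCompactSupport_bump {m : ℕ} (hG : Admissible m G) :
    HasCompactSupport (bump hG).toFun := by
  refine HasCompactSupport.intro (isCompact_closedBall 0 2) fun q hq => ?_
  have h : cutoff q = 0 := by
    apply Real.smoothTransition.zero_of_nonpos
    rw [mem_closedBall_zero_iff, not_le, Prod.norm_def, lt_max_iff, Real.norm_eq_abs] at hq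
    rcases hq with hq | hq
    · nlinarith [sq_nonneg q.2]
    · nlinarith [sq_abs q.2, sq_nonneg ‖q.1‖]
  show cutoff q • _ = _
  rw [h, zero_smul]

/-- Along the line (tu, t) the term px is t²u while the cubic is of order t³, so the second
derivative in the direction (u, 1) reads off the coefficient of px. -/
theorem bump_jet_two {m : ℕ} (hG : Admissible m G) (u y : ℍ[ℝ]) :
    (bump hG).jet 2 (u, 1) y = 2 * inner ℝ y u := by
  have hline : ContDiff ℝ ∞ fun t : ℝ => t • ((u, 1) : ℍ[ℝ] × ℝ) := by fun_prop
  rw [(bump hG).jet_eq_of_pow 2 (u, 1) y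
    (m := fun t => cutoff (t • ((u, 1) : ℍ[ℝ] × ℝ)) • (u + t • cubic u))]
  · simp [cutoff_zero]
  · exact (contDiff_cutoff.comp hline).smul (by fun_prop)
  · intro t
    show cutoff _ • ((t * 1) • t • u + cubic (t • u)) = _
    rw [cubic_smul]
    module

theorem bump_jet_three {m : ℕ} (hG : Admissible m G) (v y : ℍ[ℝ]) :
    (bump hG).jet 3 (v, 0) y = 6 * inner ℝ y (cubic v) := by
  have hline : ContDiff ℝ ∞ fun t : ℝ => t • ((v, 0) : ℍ[ℝ] × ℝ) := by fun_prop
  rw [(bump hG).jet_eq_of_pow 3 (v, 0) y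
    (m := fun t => cutoff (t • ((v, 0) : ℍ[ℝ] × ℝ)) • cubic v)]
  · simp [cutoff_zero, Nat.factorial]
  · exact (contDiff_cutoff.comp hline).smul contDiff_const
  · intro t
    show cutoff _ • ((t * 0) • t • v + cubic (t • v)) = _
    rw [cubic_smul]
    module

end Genericity

/-! ### The generic set: openness, density, and bifurcation. -/

section Main

variable {G : Subgroup (ℍ[ℝ] ≃ₗᵢ[ℝ] ℍ[ℝ])}

namespace BifurcationProblem

/-- Six times the transversal minus the radial eigenvalue of the cubic part at `u`. -/
noncomputable def transversality (u w : ℍ[ℝ]) (F : BifurcationProblem G) : ℝ :=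
  (F.jet 3 (u + w, 0) w - F.jet 3 (u - w, 0) w) / 2 - F.jet 3 (w, 0) w - F.jet 3 (u, 0) u

/-- The bifurcation problems whose `3`-jet is nondegenerate along the direction `u`. -/
def nondegenerate (G : Subgroup (ℍ[ℝ] ≃ₗᵢ[ℝ] ℍ[ℝ])) (u w : ℍ[ℝ]) : Set (BifurcationProblem G) :=
  {F | F.jet 2 (u, 1) u ≠ 0 ∧ F.jet 3 (u, 0) u ≠ 0 ∧ F.transversality u w ≠ 0}

theorem isOpen_nondegenerate (u w : ℍ[ℝ]) : IsOpen[weakTopology G] (nondegenerate G u w) := by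
  let _ := weakTopology G
  have h : Continuous (transversality u w : BifurcationProblem G → ℝ) :=
    (((((continuous_jet _ _ _).sub (continuous_jet _ _ _)).div_const 2).sub
      (continuous_jet _ _ _)).sub (continuous_jet _ _ _))
  exact (isOpen_ne_fun (continuous_jet _ _ _) continuous_const).inter
    ((isOpen_ne_fun (continuous_jet _ _ _) continuous_const).inter
      (isOpen_ne_fun h continuous_const))

theorem transversality_addSMul (u w : ℍ[ℝ]) (F : BifurcationProblem G) (c : ℝ)
    (R : BifurcationProblem G) : (F.addSMul c R).transversality u w
      = F.transversality u w + c * R.transversality u w := by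
  simp only [transversality, jet_addSMul]
  ring

/-- Along F + cR, with R the bump, the three quantities are affine in c with nonzero slopes, so only
three values of c are excluded. -/
theorem dense_nondegenerate_whitney {m : ℕ} (hG : Admissible m G) {u w : ℍ[ℝ]} (hu : InC u)
    (hw : InCj w) (huu : inner ℝ u u = (1 : ℝ)) (hww : inner ℝ w w = (1 : ℝ)) :
    @Dense _ (whitneyTopology G) (nondegenerate G u w) := by
  let _ := whitneyTopology G
  refine dense_iff_inter_open.2 fun V hV ⟨F, hF⟩ => ?_
  obtain ⟨c₀, hc₀, hc⟩ := exists_forall_addSMul_mem hV hF (hasCompactSupport_bump hG)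
  have nu := huu
  have nw := hww
  rw [inner_eq, hu.1, hu.2] at nu
  rw [inner_eq, hw.1, hw.2] at nw
  have cu : cubic u = -u := by
    ext <;> simp [cubic, normSqDiff, hu.1, hu.2]
    · linear_combination u.re * nu
    · linear_combination u.imI * nu
  have cw : cubic w = -w := by
    ext <;> simp [cubic, normSqDiff, hw.1, hw.2]
    · linear_combination (-w.imJ) * nw
    · linear_combination (-w.imK) * nw
  -- u ± w lies on the cone |z₁| = |z₂|, where `normSqDiff` vanishes.
  have cp : cubic (u + w) = 0 := by
    have : normSqDiff (u + w) = 0 := by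
      simp [normSqDiff, hu.1, hu.2, hw.1, hw.2]
      linear_combination nu - nw
    rw [cubic, this, zero_smul]
  have cm : cubic (u - w) = 0 := by
    have : normSqDiff (u - w) = 0 := by
      simp [normSqDiff, hu.1, hu.2, hw.1, hw.2]
      linear_combination nu - nw
    rw [cubic, this, zero_smul]
  have r1 : (bump hG).jet 2 (u, 1) u ≠ 0 := by rw [bump_jet_two, huu]; norm_num
  have r2 : (bump hG).jet 3 (u, 0) u ≠ 0 := by
    rw [bump_jet_three, cu, inner_neg_right, huu]; norm_num
  have r3 : (bump hG).transversality u w ≠ 0 := by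
    rw [transversality, bump_jet_three, bump_jet_three, bump_jet_three, bump_jet_three, cu, cw, cp,
      cm, inner_neg_right, inner_neg_right, huu, hww, inner_zero_right]
    norm_num
  obtain ⟨c, hc1, hc2⟩ := (Ioo_infinite hc₀).exists_notMem_finset
    {-(F.jet 2 (u, 1) u) / (bump hG).jet 2 (u, 1) u, -(F.jet 3 (u, 0) u) / (bump hG).jet 3 (u, 0) u,
      -(F.transversality u w) / (bump hG).transversality u w}
  simp only [Finset.mem_insert, Finset.mem_singleton, not_or] at hc2
  have key : ∀ {a b : ℝ}, b ≠ 0 → c ≠ -a / b → a + c * b ≠ 0 := by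
    intro a b hb h h0
    exact h (by rw [eq_div_iff hb]; linarith)
  refine ⟨F.addSMul c (bump hG), hc c hc1.1 hc1.2, ?_, ?_, ?_⟩
  · rw [jet_addSMul]; exact key r1 hc2.1
  · rw [jet_addSMul]; exact key r2 hc2.2.1
  · rw [transversality_addSMul]; exact key r3 hc2.2.2

-- The three jet conditions translate into d ≠ 0, α ≠ 0 and β ≠ α for the expansion of F.
set_option maxSynthPendingDepth 3 in
theorem bifurcation_of_nondegenerate {m : ℕ} (hm : 3 ≤ m) (hG : Admissible m G) {l r : unitary ℍ[ℝ]}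
    (hlr : rot l r ∈ G) {u w : ℍ[ℝ]} (hu : InC u) (hw : InCj w) (huu : inner ℝ u u = (1 : ℝ))
    (hww : inner ℝ w w = (1 : ℝ))
    (hfix : ∀ x, x + rot l r x = (2 * inner ℝ u x) • u + (2 * inner ℝ w x) • w)
    {F : BifurcationProblem G} (hF : F ∈ nondegenerate G u w) :
    F.LosesStability ∧ F.HasNontrivialBranch := by
  obtain ⟨B, T, d, hB, hT, hexp, hB0, hTG, σ, hσ, hσd⟩ :=
    F.exists_expansion (hG.absolutelyIrreducible hm) hG.rot_i
  obtain ⟨h1, h2, h3⟩ := hF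
  have j2 : F.jet 2 (u, 1) u = 2 * d := by
    rw [F.jet_eq_of_pow 2 (u, 1) u (m := fun t => B (t • u, t) u + t • T (t • u) u u u)]
    · simp only [zero_smul, add_zero, hB0, inner_smul_right, huu, mul_one]
      norm_num [Nat.factorial]
    · fun_prop
    · intro t
      rw [Prod.smul_mk, smul_eq_mul, mul_one, hexp]
      simp only [map_smul, smul_apply]
      module
  have j3 : ∀ v y, F.jet 3 (v, 0) y = 6 * inner ℝ y (T 0 v v v) := by
    intro v y
    rw [F.jet_eq_of_pow 3 (v, 0) y (m := fun t => T (t • v) v v v)]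
    · simp [Nat.factorial]
    · fun_prop
    · intro t
      rw [Prod.smul_mk, smul_zero, hexp]
      simp only [map_smul, smul_apply]
      module
  have huw : inner ℝ u w = (0 : ℝ) := by simp [inner_eq, hu.1, hu.2, hw.1, hw.2]
  have hwu : inner ℝ w u = (0 : ℝ) := by rw [real_inner_comm, huw]
  have two_smul_cancel : ∀ {x y : ℍ[ℝ]}, x + y = (2 * 1 : ℝ) • x → y = x := by
    intro x y h
    rw [mul_one, two_smul] at h
    exact add_left_cancel h
  have hlu : rot l r u = u := two_smul_cancel (by
    rw [hfix, huu, hwu, mul_zero, zero_smul, add_zero])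
  have hlw : rot l r w = w := two_smul_cancel (by
    rw [hfix, hww, huw, mul_zero, zero_smul, zero_add])
  have hd : d ≠ 0 := fun h => h1 (by rw [j2, h, mul_zero])
  have hα : (inner ℝ u (T 0 u u u) : ℝ) ≠ 0 := fun h => h2 (by rw [j3, h, mul_zero])
  have hβ : (inner ℝ w (T 0 u u w + T 0 u w u + T 0 w u u) - inner ℝ u (T 0 u u u) : ℝ) ≠ 0 := by
    intro h
    apply h3
    -- Half the difference of the values at u + w and u − w keeps the terms odd in w; subtracting
    -- the pure w-term then isolates β.
    have ep := trilinear_expand (T 0) u w 1 1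
    have em := trilinear_expand (T 0) u w 1 (-1)
    rw [one_smul, one_smul] at ep
    rw [one_smul, neg_one_smul, ← sub_eq_add_neg] at em
    rw [transversality, j3, j3, j3, j3, ep, em]
    generalize T 0 u u w + T 0 u w u + T 0 w u u = X at *
    generalize T 0 u w w + T 0 w u w + T 0 w w u = Y at *
    simp only [inner_add_right, inner_smul_right]
    linear_combination 6 * h
  refine ⟨⟨σ, d, hσ, hσd, hd⟩, ?_⟩
  refine exists_branch_of_nondegenerate hB hT hexp hB0 huu hww huw ?_ rfl ?_ rfl hd hα hβ
  -- On the plane the value of F is fixed by `[l, r]`, hence determined by its components along u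
  -- and w.
  · intro a b p hu0 hw0
    have h := hfix (F.toFun (a • u + b • w, p))
    rw [← F.equivariant _ hlr, map_add, map_smul, map_smul, hlu, hlw, hu0, hw0] at h
    simp only [mul_zero, zero_smul, add_zero] at h
    exact eq_zero_of_eq_neg (add_eq_zero_iff_eq_neg.1 h)
  · have h := inC_cubic_of_equivariant hm (T 0) (hTG _ hG.rot_e) (hTG _ hG.rot_i) hu
    simp [inner_eq, h.1, h.2, hw.1, hw.2]

end BifurcationProblem

end Main

end Ize

theorem mainTheorem5 (m : ℕ) (hm : 3 ≤ m) (hodd : Odd m)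
    (G : Subgroup (ℍ[ℝ] ≃ₗᵢ[ℝ] ℍ[ℝ]))
    (hG : G = Ize.G₁ m ∨ G = Ize.G₂ m ∨ G = Ize.G₃ m) :
    Ize.AbsolutelyIrreducible G ∧
    ∃ U : Set (Ize.BifurcationProblem G),
      (∀ τ : TopologicalSpace (Ize.BifurcationProblem G),
        τ = Ize.BifurcationProblem.weakTopology G ∨ τ = Ize.BifurcationProblem.whitneyTopology G →
        @IsOpen (Ize.BifurcationProblem G) τ U ∧ @Dense (Ize.BifurcationProblem G) τ U) ∧
      ∀ F ∈ U, F.LosesStability ∧ F.HasNontrivialBranch := by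
  have hA := Ize.admissible_of_mem hG
  refine ⟨hA.absolutelyIrreducible hm, ?_⟩
  obtain ⟨l, r, hl, hr, hlr⟩ := hA.exists_diag
  obtain ⟨u, w, hu, hw, huu, hww, hfix⟩ := Ize.exists_frame l r hl hr
  have hopen := Ize.BifurcationProblem.isOpen_nondegenerate (G := G) u w
  have hdense := Ize.BifurcationProblem.dense_nondegenerate_whitney hA hu hw huu hww
  refine ⟨Ize.BifurcationProblem.nondegenerate G u w, ?_, fun F hF =>
    Ize.BifurcationProblem.bifurcation_of_nondegenerate hm hA hlr hu hw huu hww hfix hF⟩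
  rintro τ (rfl | rfl)
  · refine ⟨hopen, ?_⟩
    -- Every weakly open set is Whitney open, so Whitney density implies weak density.
    rw [@dense_iff_inter_open _ (Ize.BifurcationProblem.weakTopology G)]
    intro V hV hne
    exact (@dense_iff_inter_open _ (Ize.BifurcationProblem.whitneyTopology G) _).1 hdense V
      (Ize.BifurcationProblem.isOpen_whitney_of_weak hV) hne
  · exact ⟨Ize.BifurcationProblem.isOpen_whitney_of_weak hopen, hdense⟩
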